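/- Let $M$ be a compact connected Riemann surface of genus $g\ge 2$ and let $\omega$ be a holomorphic differential on $M$ with $\frac{i}{2}\int_M\omega\wedge\bar\omega=1$, so that $|\omega|$ is a flat metric of total area $1$ with conical singularities at the zeros of $\omega$. A regular closed geodesic of direction $\theta$ is a closed geodesic of this metric that avoids the zeros of $\omega$ and whose unit tangent vectors $v$ satisfy $\omega(v)=e^{i\theta}$; the regular closed geodesics of a given direction fill cylinders, and the length of a cylinder is the common length of the closed geodesics in it. For $R>0$ let $\Theta^*_\omega(R)\subset[0,2\pi)$ be the set of directions $\theta$ such that the union of the cylinders of direction $\theta$ and length at most $R$ has area at least $\frac35$. When this set is finite and nonempty write $\Theta^*_\omega(R)=\{\theta_1<\theta_2<\dots<\theta_N\}$ with $N=|\Theta^*_\omega(R)|$, and let $\theta_{N+1}=\theta_1+2\pi$ (gaps are taken cyclically). Theorem. Suppose that $|\Theta^*_\omega(R)|$ grows quadratically, that is, there are constants $0<c_1\le c_2<\infty$ with $c_1R^2\le|\Theta^*_\omega(R)|\le c_2R^2$ for all sufficiently large $R$. Then $$\liminf_{\sigma\to\infty}\ \liminf_{R\to\infty}\ \sigma^2\,\frac{\left|\left\{1\le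 i\le N:\ \theta_{i+1}-\theta_i\ge \frac{\sigma}{R^2}\right\}\right|}{|\Theta^*_\omega(R)|}>0,$$ where the lower limits are taken in $[-\infty,+\infty]$. -/

import Mathlib

open scoped Manifold
open Filter MeasureTheory

noncomputable section

namespace TranslationSurface

section Differentials

variable (M : Type*) [TopologicalSpace M] [ChartedSpace ℂ M]

/-- Sections of the (complex) cotangent bundle of a Riemann surface `M`, with no regularity. -/
abbrev OneForm : Type _ :=
  (x : M) → (TangentSpace 𝓘(ℂ, ℂ) x →L[ℂ] ℂ)

variable {M}

/-- The function `f` such that the one-form is `f(z) dz` in the coordinate `e`. It is meaningful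
on `e.target`. -/
def coeff (α : OneForm M) (e : OpenPartialHomeomorph M ℂ) (z : ℂ) : ℂ :=
  α (e.symm z) (mfderiv 𝓘(ℂ, ℂ) 𝓘(ℂ, ℂ) e.symm z (1 : ℂ))

variable (M)

/-- The complex vector space of holomorphic differentials on `M`: one-forms that are `f(z) dz`
with `f` holomorphic in every coordinate of the atlas. -/
def holomorphicDifferentials : Submodule ℂ (OneForm M) where
  carrier := {α | ∀ e ∈ atlas ℂ M, DifferentiableOn ℂ (coeff α e) e.target}
  add_mem' ha hb := fun e he => (ha e he).add (hb e he)
  zero_mem' := fun _ _ => differentiableOn_const (0 : ℂ)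
  smul_mem' c _ ha := fun e he => (ha e he).const_smul c

/-- The genus of a compact Riemann surface: the dimension of its space of holomorphic
differentials. -/
def genus : ℕ := Module.finrank ℂ (holomorphicDifferentials M)

end Differentials

section Flat

variable {M : Type*} [TopologicalSpace M] [ChartedSpace ℂ M]

/-- The area measure `(i/2) α ∧ conj α` of a holomorphic differential. Where `α = f(z) dz` in a
coordinate `e`, it is `|f(z)|² dx dy`. These local measures agree on overlaps of charts, so that
their supremum (the least measure that dominates all of them) is the measure they glue to. -/
def area [MeasurableSpace M] (α : OneForm M) : Measure M :=
  ⨆ e ∈ atlas ℂ M,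
    Measure.map e.symm ((volume.restrict e.target).withDensity fun z => ‖coeff α e z‖ₑ ^ 2)

/-- `γ` is a complete unit speed geodesic in direction `θ` of the flat metric `|α|`, not meeting
any zero of `α`: it is differentiable with `α (γ' t) = exp (i θ)` for all `t`, i.e. a straight
line of direction `θ` in the flat charts `∫ α`. (At a zero of `α` the equation cannot hold.) -/
def IsRegularGeodesic (α : OneForm M) (θ : ℝ) (γ : ℝ → M) : Prop :=
  ∀ t : ℝ, ∃ v : TangentSpace 𝓘(ℝ, ℂ) (γ t),
    HasMFDerivAt 𝓘(ℝ, ℝ) 𝓘(ℝ, ℂ) γ t ((1 : ℝ →L[ℝ] ℝ).smulRight v) ∧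
      α (γ t) v = Complex.exp (θ * Complex.I)

/-- The union of the periodic cylinders of direction `θ` and length at most `R`: the set of
points on a regular closed geodesic of direction `θ` whose length `ℓ` is at most `R`. -/
def cylinders (α : OneForm M) (θ R : ℝ) : Set M :=
  {x | ∃ γ : ℝ → M, ∃ ℓ : ℝ, IsRegularGeodesic α θ γ ∧ γ 0 = x ∧
    0 < ℓ ∧ ℓ ≤ R ∧ Function.Periodic γ ℓ}

/-- The set `Θ*(R)` of directions in `[0, 2π)` in which the cylinders of length at most `R` have
total area at least `3/5`. -/
def directions [MeasurableSpace M] (α : OneForm M) (R : ℝ) : Set ℝ :=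
  {θ | θ ∈ Set.Ico 0 (2 * Real.pi) ∧ 3 / 5 ≤ area α (cylinders α θ R)}

end Flat

/-- The gap from `θ` to the next element of a finite set `S` of angles in `[0, 2π)` in cyclic
order: if `S = {θ₁ < ... < θₙ}`, the gap of `θᵢ` is `θᵢ₊₁ - θᵢ` for `i < n` and that of `θₙ` is
`θ₁ + 2π - θₙ`. -/
def gap (S : Set ℝ) (θ : ℝ) : ℝ :=
  sInf {d : ℝ | 0 < d ∧ ∃ φ ∈ S, ∃ k : ℤ, d = φ + 2 * Real.pi * k - θ}

/-- The proportion of the gaps of a finite set `S` of angles that have size at least `δ`. -/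
def gapProportion (S : Set ℝ) (δ : ℝ) : ℝ :=
  ({θ ∈ S | δ ≤ gap S θ}.ncard : ℝ) / (S.ncard : ℝ)

end TranslationSurface

end

/-!
Directions of cylinders repel each other. Let `θ` and `φ` be neither equal nor opposite, and suppose
that the cylinders of direction `θ` and length at most `r`, and those of direction `φ` and length at
most `R`, have area at least `3/5` each. As the total area is `1`, some set `E` of area at least
`1/5` lies in both. Put `η = R |sin (φ - θ)|`. The closed geodesic of direction `φ` through a point
of `E` rises by at most `η` above the geodesic of direction `θ`. If the `θ`-cylinder reached further
than `η` to one side of the point, then the flat map that parametrizes it would be doubly periodic,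
hence onto, and `ω` would have no zeros (`IsMaxStrip.forall_ne_zero`); but `ω` has a zero when the
genus is at least two (`exists_zero_of_two_le_genus`). So `E` is covered by `θ`-cylinders of length
at most `r` and height at most `2η` (`IsMaxStrip.subset_Icc_of_mem_cylinders`), each of area at most
`2rη` (`IsFlatStrip.area_image_le`).

The number of these cylinders is bounded independently of `θ`. The upper boundary of each contains a
zero of `ω`, into which a vertical segment of the cylinder runs (`IsMaxStrip.exists_separatrix`).
Near a zero a primitive `W` of `ω` takes each value a bounded number of times (`IsZeroChart`), and
the segment is mapped by `W` to a fixed segment ending at `0`; two segments through the same point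
belong to the same cylinder. Hence `1/5 ≤ K · 2 r R |sin (φ - θ)|` with a constant `K`, so that
`|sin (φ - θ)| ≥ κ / (r R)` (`exists_le_abs_sin`).

With `r = κ R / σ` this bound is `σ / R²`. So every direction of `Θ*(κ R / σ)` is followed by a gap
of size at least `σ / R²` in `Θ*(R)`, as soon as `κ ≤ σ` and `σ / R² ≤ π`. By quadratic growth there
are at least a constant times `R² / σ²` such directions, and at most a constant times `R²`
directions altogether.

Cylinders are not constructed as sets of their own. They are handled through flat maps `f` from
horizontal strips of `ℂ` to the surface, those with `f^* ω = c dz` for a constant `c`. Such maps are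
determined by one value on convex sets (`eqOn_of_flatAt`), can be glued (`exists_glue`), and do not
increase area (`area_image_le_of_flatAt`); through each point of a cylinder there is a largest one
(`IsFlatStrip.exists_isMaxStrip`).
-/

namespace TranslationSurface

open Set Topology

/-! ### One-forms in charts and constant-velocity maps -/

section Charts

variable {M : Type*} [TopologicalSpace M] [ChartedSpace ℂ M]

/-- The coefficient of the one-form `α` at `x` in the preferred chart at `x`, that is, in the
coordinate which identifies the tangent space at `x` with `ℂ`. -/
noncomputable def OneForm.value (α : OneForm M) (x : M) : ℂ :=
  (show ℂ →L[ℂ] ℂ from α x) 1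

theorem OneForm.apply_eq (α : OneForm M) (x : M) (v : ℂ) :
    (show ℂ →L[ℂ] ℂ from α x) v = v * α.value x := by
  have h := (show ℂ →L[ℂ] ℂ from α x).map_smul v 1
  simpa [OneForm.value] using h

theorem OneForm.value_eq_zero_iff (α : OneForm M) (x : M) : α.value x = 0 ↔ α x = 0 := by
  constructor
  · intro h
    refine ContinuousLinearMap.ext fun v => ?_
    exact (α.apply_eq x v).trans (by rw [h]; exact mul_zero (M₀ := ℂ) v)
  · intro h
    unfold OneForm.value
    rw [h]
    rfl

section Transition

variable [IsManifold 𝓘(ℂ, ℂ) 1 M]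

/-- Coordinate changes of a Riemann surface are holomorphic. -/
theorem differentiableAt_transition {e e' : OpenPartialHomeomorph M ℂ} (he : e ∈ atlas ℂ M)
    (he' : e' ∈ atlas ℂ M) {z : ℂ} (hz : z ∈ e.target) (hz' : e.symm z ∈ e'.source) :
    DifferentiableAt ℂ (e' ∘ e.symm) z := by
  have h1 := mdifferentiableAt_atlas_symm (I := 𝓘(ℂ, ℂ)) he hz
  have h2 := mdifferentiableAt_atlas (I := 𝓘(ℂ, ℂ)) he' hz'
  exact mdifferentiableAt_iff_differentiableAt.1 (h2.comp z h1)

theorem coeff_eq (α : OneForm M) {e : OpenPartialHomeomorph M ℂ} (he : e ∈ atlas ℂ M) {z : ℂ}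
    (hz : z ∈ e.target) :
    coeff α e z = deriv (chartAt ℂ (e.symm z) ∘ e.symm) z * α.value (e.symm z) := by
  have h1 := (mdifferentiableAt_atlas_symm (I := 𝓘(ℂ, ℂ)) he hz).hasMFDerivAt.2
  let D : ℂ →L[ℂ] ℂ := mfderiv 𝓘(ℂ, ℂ) 𝓘(ℂ, ℂ) e.symm z
  have h2 : HasFDerivWithinAt (writtenInExtChartAt 𝓘(ℂ, ℂ) 𝓘(ℂ, ℂ) z e.symm) D
    (range 𝓘(ℂ, ℂ)) (extChartAt 𝓘(ℂ, ℂ) z z) := h1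
  have h3 : HasFDerivAt (chartAt ℂ (e.symm z) ∘ e.symm) D z := by
    simpa [writtenInExtChartAt, chartAt_self_eq, mfld_simps] using h2
  rw [h3.hasDerivAt.deriv]
  exact α.apply_eq (e.symm z) (D 1)

/-- How the coefficient of a one-form changes under a change of coordinates. -/
theorem coeff_transition (α : OneForm M) {e e' : OpenPartialHomeomorph M ℂ} (he : e ∈ atlas ℂ M)
    (he' : e' ∈ atlas ℂ M) {z : ℂ} (hz : z ∈ e.target) (hz' : e.symm z ∈ e'.source) :
    coeff α e z = coeff α e' (e' (e.symm z)) * deriv (e' ∘ e.symm) z := by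
  have hs : e'.symm (e' (e.symm z)) = e.symm z := e'.left_inv hz'
  rw [coeff_eq α he hz, coeff_eq α he' (e'.map_source hz'), hs]
  have h1 := differentiableAt_transition he he' hz hz'
  have h2 := differentiableAt_transition he' (chart_mem_atlas ℂ (e.symm z)) (e'.map_source hz')
    (by rw [hs]; exact mem_chart_source ℂ _)
  have h3 : deriv ((chartAt ℂ (e.symm z) ∘ e'.symm) ∘ (e' ∘ e.symm)) z =
      deriv (chartAt ℂ (e.symm z) ∘ e'.symm) (e' (e.symm z)) * deriv (e' ∘ e.symm) z :=
    deriv_comp (h₂ := chartAt ℂ (e.symm z) ∘ e'.symm) z h2 h1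
  have h4 : ((chartAt ℂ (e.symm z) ∘ e'.symm) ∘ (e' ∘ e.symm)) =ᶠ[𝓝 z]
      (chartAt ℂ (e.symm z) ∘ e.symm) := by
    have : ∀ᶠ y in 𝓝 z, e.symm y ∈ e'.source :=
      (e.continuousAt_symm hz).eventually_mem (e'.open_source.mem_nhds hz')
    filter_upwards [this] with y hy
    simp [e'.left_inv hy]
  rw [← h4.deriv_eq, h3]
  ring

theorem coeff_chartAt_self (α : OneForm M) (x : M) :
    coeff α (chartAt ℂ x) (chartAt ℂ x x) = α.value x := by
  have h2 := coeff_eq α (chart_mem_atlas ℂ x) (mem_chart_target ℂ x)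
  have hl : (chartAt ℂ x).symm (chartAt ℂ x x) = x := by simp [mfld_simps]
  have h4 : deriv (chartAt ℂ x ∘ (chartAt ℂ x).symm) (chartAt ℂ x x) = 1 := by
    have : (chartAt ℂ x ∘ (chartAt ℂ x).symm) =ᶠ[𝓝 (chartAt ℂ x x)] id := by
      filter_upwards [(chartAt ℂ x).open_target.mem_nhds (mem_chart_target ℂ x)] with y hy
      exact (chartAt ℂ x).right_inv hy
    rw [this.deriv_eq, deriv_id]
  rw [hl, h4, one_mul] at h2
  exact h2

theorem coeff_eq_zero_iff (α : OneForm M) {e : OpenPartialHomeomorph M ℂ} (he : e ∈ atlas ℂ M)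
    {z : ℂ} (hz : z ∈ e.target) : coeff α e z = 0 ↔ α (e.symm z) = 0 := by
  rw [← OneForm.value_eq_zero_iff]
  constructor
  · intro h
    set x := e.symm z with hx
    have hxs : x ∈ e.source := e.map_target hz
    have h1 := coeff_transition α (chart_mem_atlas ℂ x) he (z := chartAt ℂ x x)
      (mem_chart_target ℂ x) (by simpa [mfld_simps] using hxs)
    have hl : (chartAt ℂ x).symm (chartAt ℂ x x) = x := by simp [mfld_simps]
    rw [hl, show e x = z from e.right_inv hz, h, zero_mul, coeff_chartAt_self] at h1
    exact h1
  · intro h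
    rw [coeff_eq α he hz, h, mul_zero]

end Transition

/-- The map `f` from a line or from the complex plane to `M` is differentiable at `t`, and `α`
takes the value `κ` on its derivative. The derivative is computed in some chart of the atlas; see
`FlatAt.hasDerivAt_chart` for independence of the chart. -/
def FlatAt {𝕜 : Type*} [RCLike 𝕜] [NormedAlgebra 𝕜 ℂ] (α : OneForm M) (κ : ℂ) (f : 𝕜 → M)
    (t : 𝕜) : Prop :=
  ContinuousAt f t ∧ ∃ e ∈ atlas ℂ M, f t ∈ e.source ∧ ∃ v : ℂ,
    HasDerivAt (e ∘ f) v t ∧ coeff α e (e (f t)) * v = κ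

section FlatAt

variable {𝕜 : Type*} [RCLike 𝕜] [NormedAlgebra 𝕜 ℂ] {α : OneForm M} {κ : ℂ}
  {f g : 𝕜 → M} {t : 𝕜}

theorem FlatAt.continuousAt (h : FlatAt α κ f t) : ContinuousAt f t := h.1

theorem FlatAt.congr (h : FlatAt α κ f t) (hfg : f =ᶠ[𝓝 t] g) : FlatAt α κ g t := by
  obtain ⟨hc, e, he, hs, v, hv, hκ⟩ := h
  have := hfg.eq_of_nhds
  refine ⟨hc.congr hfg, e, he, this ▸ hs, v, hv.congr_of_eventuallyEq ?_, this ▸ hκ⟩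
  filter_upwards [hfg] with y hy
  simp [hy]

theorem FlatAt.comp {𝕜' : Type*} [RCLike 𝕜'] [NormedAlgebra 𝕜' ℂ] {f : ℂ → M} {u : 𝕜' → ℂ}
    {s : 𝕜'} {d : ℂ} (h : FlatAt α κ f (u s)) (hu : HasDerivAt u d s) :
    FlatAt α (κ * d) (f ∘ u) s := by
  obtain ⟨hc, e, he, hs, v, hv, hκ⟩ := h
  refine ⟨hc.comp hu.continuousAt, e, he, hs, v * d, ?_, ?_⟩
  · have := (hv.hasFDerivAt.restrictScalars 𝕜').comp_hasDerivAt s hu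
    exact this.congr_deriv (by simp [mul_comm])
  · rw [← hκ]; simp [mul_assoc]

variable [IsManifold 𝓘(ℂ, ℂ) 1 M]

/-- `FlatAt` may be tested in any chart around the point. -/
theorem FlatAt.hasDerivAt_chart (h : FlatAt α κ f t) {e : OpenPartialHomeomorph M ℂ}
    (he : e ∈ atlas ℂ M) (hs : f t ∈ e.source) :
    ∃ v : ℂ, HasDerivAt (e ∘ f) v t ∧ coeff α e (e (f t)) * v = κ := by
  obtain ⟨hc, e', he', hs', v, hv, hκ⟩ := h
  have hl : e'.symm (e' (f t)) = f t := e'.left_inv hs'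
  have hmem : e'.symm (e' (f t)) ∈ e.source := by rwa [hl]
  have h1 := differentiableAt_transition he' he (e'.map_source hs') hmem
  have h2 := coeff_transition α he' he (e'.map_source hs') hmem
  rw [hl] at h2
  refine ⟨v * deriv (e ∘ e'.symm) (e' (f t)), ?_, ?_⟩
  · have h3 := ((h1.hasDerivAt).hasFDerivAt.restrictScalars 𝕜).comp_hasDerivAt (f := e' ∘ f) t hv
    have h4 : HasDerivAt ((e ∘ e'.symm) ∘ (e' ∘ f)) (v * deriv (e ∘ e'.symm) (e' (f t))) t := by
      simpa using h3
    refine h4.congr_of_eventuallyEq ?_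
    filter_upwards [hc.eventually_mem (e'.open_source.mem_nhds hs')] with y hy
    simp [e'.left_inv hy]
  · rw [← hκ, h2]; ring

theorem FlatAt.ne_zero (h : FlatAt α κ f t) (hκ : κ ≠ 0) : α (f t) ≠ 0 := by
  intro h0
  obtain ⟨v, -, hv⟩ := h.hasDerivAt_chart (chart_mem_atlas ℂ (f t)) (mem_chart_source ℂ (f t))
  rw [(coeff_eq_zero_iff α (chart_mem_atlas ℂ (f t)) (mem_chart_target ℂ (f t))).2
    (by rwa [(chartAt ℂ (f t)).left_inv (mem_chart_source ℂ (f t))]), zero_mul] at hv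
  exact hκ hv.symm

end FlatAt

/-- Regular geodesics, defined through the tangent map over `ℝ`, are the curves of constant velocity
`exp (i θ)` in the holomorphic charts. -/
theorem isRegularGeodesic_iff [IsManifold 𝓘(ℂ, ℂ) 1 M] {α : OneForm M} {θ : ℝ} {γ : ℝ → M} :
    IsRegularGeodesic α θ γ ↔ ∀ t, FlatAt α (Complex.exp (θ * Complex.I)) γ t := by
  have key : ∀ t (v : ℂ), HasMFDerivAt 𝓘(ℝ, ℝ) 𝓘(ℝ, ℂ) γ t ((1 : ℝ →L[ℝ] ℝ).smulRight v) ↔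
      ContinuousAt γ t ∧ HasDerivAt (chartAt ℂ (γ t) ∘ γ) v t := by
    intro t v
    have h : writtenInExtChartAt 𝓘(ℝ, ℝ) 𝓘(ℝ, ℂ) t γ = chartAt ℂ (γ t) ∘ γ := by
      ext y
      simp [writtenInExtChartAt, chartAt_self_eq, mfld_simps]
    have h2 : HasMFDerivAt 𝓘(ℝ, ℝ) 𝓘(ℝ, ℂ) γ t ((1 : ℝ →L[ℝ] ℝ).smulRight v) ↔
        ContinuousAt γ t ∧ HasFDerivWithinAt (writtenInExtChartAt 𝓘(ℝ, ℝ) 𝓘(ℝ, ℂ) t γ)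
        ((1 : ℝ →L[ℝ] ℝ).smulRight v) (range 𝓘(ℝ, ℝ)) (extChartAt 𝓘(ℝ, ℝ) t t) := Iff.rfl
    rw [h2, h, hasDerivAt_iff_hasFDerivAt]
    simp only [mfld_simps, hasFDerivWithinAt_univ]
    refine and_congr_right fun _ => ?_
    rw [show (ContinuousLinearMap.toSpanSingleton ℝ v) = (1 : ℝ →L[ℝ] ℝ).smulRight v by
      ext; simp]
    rfl
  refine forall_congr' fun t => ⟨?_, ?_⟩
  · rintro ⟨v, hv, hα⟩
    obtain ⟨h1, h2⟩ := (key t v).1 hv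
    refine ⟨h1, _, chart_mem_atlas ℂ _, mem_chart_source ℂ _, v, h2, ?_⟩
    rw [coeff_chartAt_self]
    refine (mul_comm (G := ℂ) (α.value (γ t)) v).trans ?_
    exact (OneForm.apply_eq α (γ t) v).symm.trans hα
  · intro h
    obtain ⟨v, h2, hv⟩ := h.hasDerivAt_chart (chart_mem_atlas ℂ (γ t)) (mem_chart_source ℂ (γ t))
    refine ⟨v, (key t v).2 ⟨h.1, h2⟩, ?_⟩
    rw [coeff_chartAt_self, mul_comm] at hv
    rw [← hv]
    exact OneForm.apply_eq α (γ t) v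

end Charts

/-! ### Flat charts -/

section FlatCharts

variable {M : Type*} [TopologicalSpace M] [ChartedSpace ℂ M]

/-- A local coordinate `ψ` of `M` in which the one-form `α` is `dz`. -/
structure IsFlatChart (α : OneForm M) (ψ : OpenPartialHomeomorph M ℂ) : Prop where
  hasDerivAt : ∀ {κ : ℂ} {γ : ℝ → M} {t : ℝ}, FlatAt α κ γ t → γ t ∈ ψ.source →
    HasDerivAt (ψ ∘ γ) κ t
  flatAt_symm : ∀ z ∈ ψ.target, FlatAt α 1 ψ.symm z

/-- `P` is a primitive of the coefficient of `α` in the preferred chart at `q`, on the ball of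
radius `ρ` around the image of `q`, and it vanishes there at the centre. -/
structure IsPrimitiveAt (α : OneForm M) (q : M) (P : ℂ → ℂ) (ρ : ℝ) : Prop where
  pos : 0 < ρ
  ball_subset : Metric.ball (chartAt ℂ q q) ρ ⊆ (chartAt ℂ q).target
  apply_center : P (chartAt ℂ q q) = 0
  hasDerivAt : ∀ z ∈ Metric.ball (chartAt ℂ q q) ρ, HasDerivAt P (coeff α (chartAt ℂ q) z) z

theorem exists_isPrimitiveAt {α : OneForm M} (hα : α ∈ holomorphicDifferentials M) (q : M) :
    ∃ P ρ, IsPrimitiveAt α q P ρ := by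
  obtain ⟨ρ, hρ, hsub⟩ := Metric.isOpen_iff.1 (chartAt ℂ q).open_target _ (mem_chart_target ℂ q)
  have hd : DifferentiableOn ℂ (coeff α (chartAt ℂ q)) (Metric.ball (chartAt ℂ q q) ρ) :=
    (hα _ (chart_mem_atlas ℂ q)).mono hsub
  obtain ⟨P, hP0, hP⟩ := hd.isExactOn_ball.with_val_at (chartAt ℂ q q) 0
  refine ⟨P, ρ, hρ, hsub, ?_, ?_⟩
  · exact hP0
  · exact hP

theorem hasDerivAt_lineMap (a d : ℂ) (t : ℝ) :
    HasDerivAt (fun s : ℝ => a + (s : ℂ) * d) d t := by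
  simpa using ((Complex.ofRealCLM.hasDerivAt (x := t)).mul_const d).const_add a

theorem hasDerivAt_affine (a c z : ℂ) : HasDerivAt (fun w : ℂ => a + c * w) c z := by
  simpa using ((hasDerivAt_id z).const_mul c).const_add a

theorem FlatAt.comp_line {α : OneForm M} {κ : ℂ} {f : ℂ → M} {a d : ℂ} {t : ℝ}
    (h : FlatAt α κ f (a + (t : ℂ) * d)) : FlatAt α (κ * d) (fun s : ℝ => f (a + (s : ℂ) * d)) t :=
  FlatAt.comp (u := fun s : ℝ => a + (s : ℂ) * d) h (hasDerivAt_lineMap a d t)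

theorem FlatAt.comp_affine {α : OneForm M} {κ : ℂ} {f : ℂ → M} {a c z : ℂ}
    (h : FlatAt α κ f (a + c * z)) : FlatAt α (κ * c) (fun w => f (a + c * w)) z :=
  FlatAt.comp (u := fun w : ℂ => a + c * w) h (hasDerivAt_affine a c z)

variable [IsManifold 𝓘(ℂ, ℂ) 1 M]

theorem IsPrimitiveAt.hasDerivAt_comp {𝕜 : Type*} [RCLike 𝕜] [NormedAlgebra 𝕜 ℂ] {α : OneForm M}
    {q : M} {P : ℂ → ℂ} {ρ : ℝ} (hP : IsPrimitiveAt α q P ρ) {κ : ℂ} {f : 𝕜 → M} {t : 𝕜}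
    (hf : FlatAt α κ f t) (hs : f t ∈ (chartAt ℂ q).source)
    (hb : chartAt ℂ q (f t) ∈ Metric.ball (chartAt ℂ q q) ρ) :
    HasDerivAt (fun s => P (chartAt ℂ q (f s))) κ t := by
  obtain ⟨v, hv, hκ⟩ := hf.hasDerivAt_chart (chart_mem_atlas ℂ q) hs
  have := ((hP.hasDerivAt _ hb).hasFDerivAt.restrictScalars 𝕜).comp_hasDerivAt
    (f := chartAt ℂ q ∘ f) t hv
  exact this.congr_deriv (by rw [← hκ]; simp [mul_comm])

/-- Away from its zeros, a holomorphic differential is `dz` in a suitable coordinate. -/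
theorem exists_isFlatChart {α : OneForm M} (hα : α ∈ holomorphicDifferentials M) {q : M}
    (hq : α q ≠ 0) : ∃ ψ : OpenPartialHomeomorph M ℂ, IsFlatChart α ψ ∧ q ∈ ψ.source := by
  obtain ⟨P, ρ, hP⟩ := exists_isPrimitiveAt hα q
  set e := chartAt ℂ q with he
  set B := Metric.ball (e q) ρ with hB
  have hqB : e q ∈ B := Metric.mem_ball_self hP.pos
  have hcoeff : DifferentiableOn ℂ (coeff α e) B :=
    (hα _ (chart_mem_atlas ℂ q)).mono hP.ball_subset
  have hne : coeff α e (e q) ≠ 0 := by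
    rw [he, coeff_chartAt_self]
    exact fun h => hq ((OneForm.value_eq_zero_iff α q).1 h)
  have hPd : DifferentiableOn ℂ P B := fun z hz =>
    (hP.hasDerivAt z hz).differentiableAt.differentiableWithinAt
  have han : AnalyticAt ℂ P (e q) := hPd.analyticAt (Metric.isOpen_ball.mem_nhds hqB)
  have hstrict : HasStrictDerivAt P (coeff α e (e q)) (e q) := by
    have := han.hasStrictDerivAt
    rwa [(hP.hasDerivAt _ hqB).deriv] at this
  have hev : ∀ᶠ z in 𝓝 (e q), z ∈ B ∧ coeff α e z ≠ 0 :=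
    Filter.Eventually.and (Metric.isOpen_ball.mem_nhds hqB)
      ((hcoeff.continuousOn.continuousAt (Metric.isOpen_ball.mem_nhds hqB)).eventually_ne hne)
  obtain ⟨s, hs, hso, hqs⟩ := eventually_nhds_iff.1 hev
  -- The primitive `P` is a local coordinate near `e q`, and `e` followed by `P` is a flat chart.
  let Φ : OpenPartialHomeomorph ℂ ℂ :=
    ((hstrict.hasStrictFDerivAt_equiv hne).toOpenPartialHomeomorph P).restrOpen s hso
  have hΦ : ∀ z, Φ z = P z := fun z => rfl
  have hΦs : ∀ z ∈ Φ.source, z ∈ s := fun z hz => hz.2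
  have hqΦ : e q ∈ Φ.source :=
    ⟨(hstrict.hasStrictFDerivAt_equiv hne).mem_toOpenPartialHomeomorph_source, hqs⟩
  refine ⟨e.trans Φ, ⟨?_, ?_⟩, ?_⟩
  · intro κ γ t hγ ht
    rw [OpenPartialHomeomorph.trans_source] at ht
    exact hP.hasDerivAt_comp hγ ht.1 (hs _ (hΦs _ ht.2)).1
  · intro z hz
    have hz1 : z ∈ Φ.target := by
      rw [OpenPartialHomeomorph.trans_target] at hz; exact hz.1
    have hz2 : Φ.symm z ∈ e.target := by
      rw [OpenPartialHomeomorph.trans_target] at hz; exact hz.2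
    refine ⟨(e.trans Φ).continuousAt_symm hz, e, chart_mem_atlas ℂ q, e.map_target hz2,
      (coeff α e (Φ.symm z))⁻¹, ?_, ?_⟩
    · have h1 := hs _ (hΦs _ (Φ.map_target hz1))
      have h2 := Φ.hasDerivAt_symm hz1 h1.2 (hP.hasDerivAt _ h1.1)
      refine h2.congr_of_eventuallyEq ?_
      filter_upwards [(e.trans Φ).open_target.mem_nhds hz] with y hy
      rw [OpenPartialHomeomorph.trans_target] at hy
      exact e.right_inv hy.2
    · have h1 := hs _ (hΦs _ (Φ.map_target hz1))
      have : e ((e.trans Φ).symm z) = Φ.symm z := e.right_inv hz2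
      rw [this, mul_inv_cancel₀ h1.2]
  · rw [OpenPartialHomeomorph.trans_source]
    exact ⟨mem_chart_source ℂ q, hqΦ⟩

/-- Two curves with the same constant `α`-velocity that meet at one time of an interval agree
on the whole interval. -/
theorem eqOn_of_flatAt_real [T2Space M] {α : OneForm M} (hα : α ∈ holomorphicDifferentials M)
    {κ : ℂ} (hκ : κ ≠ 0) {γ γ' : ℝ → M} {S : Set ℝ} (hS : S.OrdConnected)
    (h : ∀ t ∈ S, FlatAt α κ γ t) (h' : ∀ t ∈ S, FlatAt α κ γ' t) {t₀ : ℝ} (ht₀ : t₀ ∈ S)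
    (heq : γ t₀ = γ' t₀) : EqOn γ γ' S := by
  have hpre : IsPreconnected S := hS.isPreconnected
  have hcl : IsClosed {t : S | γ t = γ' t} := by
    refine isClosed_eq ?_ ?_
    · exact continuous_iff_continuousAt.2 fun t =>
        (h t t.2).continuousAt.comp continuous_subtype_val.continuousAt
    · exact continuous_iff_continuousAt.2 fun t =>
        (h' t t.2).continuousAt.comp continuous_subtype_val.continuousAt
  have hop : IsOpen {t : S | γ t = γ' t} := by
    rw [isOpen_iff_mem_nhds]
    rintro ⟨t, ht⟩ (hteq : γ t = γ' t)
    -- In a flat chart both curves have velocity `κ`, so that their difference is constant.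
    obtain ⟨ψ, hψ, hq⟩ := exists_isFlatChart hα ((h t ht).ne_zero hκ)
    have hev : ∀ᶠ s in 𝓝 t, γ s ∈ ψ.source ∧ γ' s ∈ ψ.source :=
      ((h t ht).continuousAt.eventually_mem (ψ.open_source.mem_nhds hq)).and
        ((h' t ht).continuousAt.eventually_mem (ψ.open_source.mem_nhds (hteq ▸ hq)))
    obtain ⟨ε, hε, hball⟩ := Metric.eventually_nhds_iff_ball.1 hev
    have key : ∀ s ∈ Metric.ball t ε ∩ S, γ s = γ' s := by
      intro s hs
      have hconv : Convex ℝ (Metric.ball t ε ∩ S) :=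
        (convex_ball t ε).inter hS.convex
      have hd : ∀ r ∈ Metric.ball t ε ∩ S,
          HasDerivWithinAt (fun r => ψ (γ r) - ψ (γ' r)) 0 (Metric.ball t ε ∩ S) r := by
        intro r hr
        have h1 := hψ.hasDerivAt (h r hr.2) (hball r hr.1).1
        have h2 := hψ.hasDerivAt (h' r hr.2) (hball r hr.1).2
        have := h1.sub h2
        rw [sub_self] at this
        exact this.hasDerivWithinAt
      have hb := hconv.norm_image_sub_le_of_norm_hasDerivWithin_le (C := 0) hd (by simp)
        ⟨Metric.mem_ball_self hε, ht⟩ hs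
      simp only [hteq, sub_self, sub_zero, zero_mul, norm_le_zero_iff] at hb
      exact ψ.injOn (hball s hs.1).1 (hball s hs.1).2 (sub_eq_zero.1 hb)
    have : (Subtype.val ⁻¹' (Metric.ball t ε) : Set S) ∈ 𝓝 (⟨t, ht⟩ : S) :=
      continuous_subtype_val.continuousAt.preimage_mem_nhds (Metric.ball_mem_nhds t hε)
    filter_upwards [this] with s hs
    exact key s ⟨hs, s.2⟩
  have huniv : {t : S | γ t = γ' t} = univ := by
    have : PreconnectedSpace S := isPreconnected_iff_preconnectedSpace.1 hpre
    exact IsClopen.eq_univ ⟨hcl, hop⟩ ⟨⟨t₀, ht₀⟩, heq⟩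
  intro t ht
  have : (⟨t, ht⟩ : S) ∈ {t : S | γ t = γ' t} := huniv ▸ mem_univ _
  exact this

/-- Two maps from a convex set with the same constant `α`-derivative that agree at one point are
equal. -/
theorem eqOn_of_flatAt [T2Space M] {α : OneForm M} (hα : α ∈ holomorphicDifferentials M)
    {κ : ℂ} (hκ : κ ≠ 0) {f g : ℂ → M} {U : Set ℂ} (hU : Convex ℝ U)
    (hf : ∀ z ∈ U, FlatAt α κ f z) (hg : ∀ z ∈ U, FlatAt α κ g z) {a : ℂ} (ha : a ∈ U)
    (heq : f a = g a) : EqOn f g U := by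
  intro z hz
  rcases eq_or_ne z a with rfl | hza
  · exact heq
  have hseg : ∀ t ∈ Icc (0 : ℝ) 1, a + (t : ℂ) * (z - a) ∈ U := by
    intro t ht
    have := hU.add_smul_sub_mem ha hz ht
    simpa using this
  have := eqOn_of_flatAt_real hα (mul_ne_zero hκ (sub_ne_zero.2 hza))
    (γ := fun t : ℝ => f (a + (t : ℂ) * (z - a))) (γ' := fun t : ℝ => g (a + (t : ℂ) * (z - a)))
    (ordConnected_Icc (a := (0 : ℝ)) (b := 1))
    (fun t ht => (hf _ (hseg t ht)).comp_line)
    (fun t ht => (hg _ (hseg t ht)).comp_line)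
    (left_mem_Icc.2 zero_le_one) (by simpa using heq) (right_mem_Icc.2 zero_le_one)
  simpa using this

/-- Near a point where `α` does not vanish, flat discs of a common radius exist around all
points. -/
theorem exists_uniform_disc_nhds {α : OneForm M} (hα : α ∈ holomorphicDifferentials M) {q : M}
    (hq : α q ≠ 0) : ∃ V ∈ 𝓝 q, ∃ ρ > 0, ∀ y ∈ V, ∀ c : ℂ, ‖c‖ = 1 →
      ∃ g : ℂ → M, g 0 = y ∧ ∀ z ∈ Metric.ball (0 : ℂ) ρ, FlatAt α c g z := by
  obtain ⟨ψ, hψ, hs⟩ := exists_isFlatChart hα hq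
  obtain ⟨ρ, hρ, hsub⟩ := Metric.isOpen_iff.1 ψ.open_target _ (ψ.map_source hs)
  refine ⟨{y | y ∈ ψ.source ∧ ψ y ∈ Metric.ball (ψ q) (ρ / 2)}, ?_, ρ / 2, by positivity, ?_⟩
  · exact Filter.Eventually.and (ψ.open_source.mem_nhds hs)
      ((ψ.continuousAt hs).eventually_mem (Metric.ball_mem_nhds _ (by positivity)))
  · rintro y ⟨hy, hyb⟩ c hc
    refine ⟨fun z => ψ.symm (ψ y + c * z), by simp [ψ.left_inv hy], fun z hz => ?_⟩
    have hmem : ψ y + c * z ∈ ψ.target := by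
      apply hsub
      rw [Metric.mem_ball, dist_eq_norm] at hyb ⊢
      rw [mem_ball_zero_iff] at hz
      calc ‖ψ y + c * z - ψ q‖ = ‖(ψ y - ψ q) + c * z‖ := by ring_nf
        _ ≤ ‖ψ y - ψ q‖ + ‖c * z‖ := norm_add_le _ _
        _ < ρ := by rw [norm_mul, hc, one_mul]; linarith
    simpa using (hψ.flatAt_symm _ hmem).comp_affine

/-- On a compact set without zeros of `α`, flat discs of a common radius exist around all
points. -/
theorem exists_uniform_disc {α : OneForm M} (hα : α ∈ holomorphicDifferentials M) {K : Set M}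
    (hK : IsCompact K) (h0 : ∀ q ∈ K, α q ≠ 0) : ∃ ρ > 0, ∀ y ∈ K, ∀ c : ℂ, ‖c‖ = 1 →
      ∃ g : ℂ → M, g 0 = y ∧ ∀ z ∈ Metric.ball (0 : ℂ) ρ, FlatAt α c g z := by
  refine hK.induction_on (p := fun S => ∃ ρ > (0 : ℝ), ∀ y ∈ S, ∀ c : ℂ, ‖c‖ = 1 →
      ∃ g : ℂ → M, g 0 = y ∧ ∀ z ∈ Metric.ball (0 : ℂ) ρ, FlatAt α c g z) ?_ ?_ ?_ ?_
  · exact ⟨1, one_pos, by simp⟩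
  · rintro s t hst ⟨ρ, hρ, h⟩
    exact ⟨ρ, hρ, fun y hy => h y (hst hy)⟩
  · rintro s t ⟨ρ, hρ, h⟩ ⟨ρ', hρ', h'⟩
    refine ⟨min ρ ρ', lt_min hρ hρ', ?_⟩
    rintro y (hy | hy) c hc
    · obtain ⟨g, hg, hz⟩ := h y hy c hc
      exact ⟨g, hg, fun z hz' => hz z (Metric.ball_subset_ball (min_le_left _ _) hz')⟩
    · obtain ⟨g, hg, hz⟩ := h' y hy c hc
      exact ⟨g, hg, fun z hz' => hz z (Metric.ball_subset_ball (min_le_right _ _) hz')⟩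
  · intro q hq
    obtain ⟨V, hV, ρ, hρ, h⟩ := exists_uniform_disc_nhds hα (h0 q hq)
    exact ⟨V, mem_nhdsWithin_of_mem_nhds hV, ρ, hρ, h⟩

/-- A flat map is near each point an affine map followed by the inverse of a flat chart. -/
theorem FlatAt.eventuallyEq_symm [T2Space M] {α : OneForm M} (hα : α ∈ holomorphicDifferentials M)
    {c : ℂ} (hc : c ≠ 0) {f : ℂ → M} {z : ℂ} (hf : ∀ᶠ w in 𝓝 z, FlatAt α c f w) :
    ∃ ψ : OpenPartialHomeomorph M ℂ, IsFlatChart α ψ ∧ ∃ a : ℂ, ∃ ε > 0,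
      ∀ w ∈ Metric.ball z ε, a + c * w ∈ ψ.target ∧ f w = ψ.symm (a + c * w) := by
  obtain ⟨ψ, hψ, hq⟩ := exists_isFlatChart hα (hf.self_of_nhds.ne_zero hc)
  have h1 : ∀ᶠ w in 𝓝 z, (ψ (f z) - c * z) + c * w ∈ ψ.target := by
    have : ContinuousAt (fun w => (ψ (f z) - c * z) + c * w) z := by fun_prop
    refine this.eventually_mem (ψ.open_target.mem_nhds ?_)
    simpa using ψ.map_source hq
  obtain ⟨ε, hε, h⟩ := Metric.eventually_nhds_iff_ball.1 (h1.and hf)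
  refine ⟨ψ, hψ, _, ε, hε, fun w hw => ⟨(h w hw).1, ?_⟩⟩
  refine eqOn_of_flatAt hα hc (convex_ball z ε) (fun w hw => (h w hw).2)
    (g := fun w => ψ.symm ((ψ (f z) - c * z) + c * w)) (fun w hw => ?_)
    (Metric.mem_ball_self hε) (by simp [ψ.left_inv hq]) hw
  simpa using (hψ.flatAt_symm _ (h w hw).1).comp_affine

/-- The image of an open set under a flat map is open. -/
theorem isOpen_image_of_flatAt [T2Space M] {α : OneForm M} (hα : α ∈ holomorphicDifferentials M)
    {c : ℂ} (hc : c ≠ 0) {f : ℂ → M} {U : Set ℂ} (hU : IsOpen U) (hf : ∀ z ∈ U, FlatAt α c f z) :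
    IsOpen (f '' U) := by
  rw [isOpen_iff_mem_nhds]
  rintro _ ⟨z, hz, rfl⟩
  obtain ⟨ψ, -, a, ε, hε, h⟩ := FlatAt.eventuallyEq_symm hα hc
    (Filter.mem_of_superset (hU.mem_nhds hz) hf)
  have hfz := h z (Metric.mem_ball_self hε)
  have hmem : f z ∈ ψ.source := by rw [hfz.2]; exact ψ.map_target hfz.1
  have hψz : ψ (f z) = a + c * z := by rw [hfz.2, ψ.right_inv hfz.1]
  have hback : ContinuousAt (fun y => c⁻¹ * (ψ y - a)) (f z) :=
    ((ψ.continuousAt hmem).sub continuousAt_const).const_mul _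
  have hval : c⁻¹ * (ψ (f z) - a) = z := by rw [hψz]; field_simp; ring
  have hnhds : Metric.ball z ε ∩ U ∈ 𝓝 z := inter_mem (Metric.ball_mem_nhds z hε) (hU.mem_nhds hz)
  have := hback.preimage_mem_nhds (t := Metric.ball z ε ∩ U) (by rwa [hval])
  filter_upwards [this, ψ.open_source.mem_nhds hmem] with y hy hys
  refine ⟨c⁻¹ * (ψ y - a), hy.2, ?_⟩
  rw [(h _ hy.1).2]
  have : a + c * (c⁻¹ * (ψ y - a)) = ψ y := by field_simp; ring
  rw [this, ψ.left_inv hys]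

end FlatCharts

/-! ### Flat strips -/

section Strips

variable {M : Type*} [TopologicalSpace M] [ChartedSpace ℂ M]

/-- `f` is a flat map from the horizontal strip `{z | im z ∈ I}` to `M` that sends `0` to `x`. Here
`I` is an open interval containing `0`, possibly unbounded, and `c` is the value of `α` on the
derivative of `f`. -/
structure IsFlatStrip (α : OneForm M) (c : ℂ) (x : M) (I : Set ℝ) (f : ℂ → M) : Prop where
  isOpen : IsOpen I
  ordConnected : I.OrdConnected
  zero_mem : (0 : ℝ) ∈ I
  apply_zero : f 0 = x
  flatAt : ∀ z : ℂ, z.im ∈ I → FlatAt α c f z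

/-- A flat strip through `x` that contains all other flat strips through `x`. -/
structure IsMaxStrip (α : OneForm M) (c : ℂ) (x : M) (I : Set ℝ) (f : ℂ → M) : Prop extends
    IsFlatStrip α c x I f where
  maximal : ∀ J g, IsFlatStrip α c x J g → J ⊆ I

theorem convex_im_preimage {I : Set ℝ} (hI : I.OrdConnected) : Convex ℝ (Complex.im ⁻¹' I) :=
  hI.convex.linear_preimage Complex.imLm

theorem isOpen_im_preimage {I : Set ℝ} (hI : IsOpen I) : IsOpen (Complex.im ⁻¹' I) :=
  hI.preimage Complex.continuous_im

theorem exists_re_mem_Icc_of_periodic {X : Type*} {I : Set ℝ} {f : ℂ → X} {ℓ : ℝ} (hℓ : 0 < ℓ)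
    (hper : ∀ z : ℂ, z.im ∈ I → f (z + ℓ) = f z) {w : ℂ} (hw : w.im ∈ I) :
    ∃ w' : ℂ, w'.re ∈ Icc 0 ℓ ∧ w'.im = w.im ∧ f w' = f w := by
  have hp : Function.Periodic (fun t : ℝ => f (w + t)) ℓ := by
    intro t
    have := hper (w + t) (by simpa using hw)
    simp only [← this]
    congr 1
    push_cast
    ring
  have h1 := Int.floor_le (w.re / ℓ)
  have h2 := Int.lt_floor_add_one (w.re / ℓ)
  rw [le_div_iff₀ hℓ] at h1
  rw [div_lt_iff₀ hℓ] at h2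
  refine ⟨w + ((-⌊w.re / ℓ⌋ : ℤ) : ℂ) * ℓ, ⟨?_, ?_⟩, by simp, ?_⟩
  · simp; linarith
  · simp; linarith
  · have := hp.int_mul (-⌊w.re / ℓ⌋) 0
    simpa using this

/-- Flat maps on open sets that agree on overlaps glue to a flat map. -/
theorem exists_glue {ι : Type*} [Nonempty M] {α : OneForm M} {c : ℂ} (U : ι → Set ℂ)
    (f : ι → ℂ → M) (hU : ∀ i, IsOpen (U i)) (hf : ∀ i, ∀ z ∈ U i, FlatAt α c (f i) z)
    (hcompat : ∀ i j, EqOn (f i) (f j) (U i ∩ U j)) :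
    ∃ F : ℂ → M, (∀ i, EqOn F (f i) (U i)) ∧ ∀ i, ∀ z ∈ U i, FlatAt α c F z := by
  classical
  let F : ℂ → M := fun z =>
    if h : ∃ i, z ∈ U i then f h.choose z else Classical.arbitrary M
  have hF : ∀ i, EqOn F (f i) (U i) := by
    intro i z hz
    have h : ∃ i, z ∈ U i := ⟨i, hz⟩
    simp only [F, dif_pos h]
    exact hcompat _ _ ⟨h.choose_spec, hz⟩
  refine ⟨F, hF, fun i z hz => (hf i z hz).congr ?_⟩
  filter_upwards [(hU i).mem_nhds hz] with w hw
  exact (hF i hw).symm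

variable [IsManifold 𝓘(ℂ, ℂ) 1 M] [T2Space M] {α : OneForm M} {c : ℂ} {x : M} {I : Set ℝ}
  {f : ℂ → M}

theorem IsFlatStrip.exists_isMaxStrip (hα : α ∈ holomorphicDifferentials M) (hc : c ≠ 0)
    (h : IsFlatStrip α c x I f) : ∃ J g, IsMaxStrip α c x J g := by
  have : Nonempty M := ⟨x⟩
  obtain ⟨F, hF, hflat⟩ := exists_glue
    (ι := {p : Set ℝ × (ℂ → M) // IsFlatStrip α c x p.1 p.2})
    (fun p => Complex.im ⁻¹' p.1.1) (fun p => p.1.2)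
    (fun p => isOpen_im_preimage p.2.isOpen) (fun p => p.2.flatAt) (fun p q => by
      refine eqOn_of_flatAt hα hc
        ((convex_im_preimage p.2.ordConnected).inter (convex_im_preimage q.2.ordConnected))
        (fun z hz => p.2.flatAt z hz.1) (fun z hz => q.2.flatAt z hz.2) (a := 0) ?_ ?_
      · exact ⟨by simpa using p.2.zero_mem, by simpa using q.2.zero_mem⟩
      · rw [p.2.apply_zero, q.2.apply_zero])
  refine ⟨⋃ p : {p : Set ℝ × (ℂ → M) // IsFlatStrip α c x p.1 p.2}, p.1.1, F,
    ⟨?_, ?_, ?_, ?_, ?_⟩, ?_⟩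
  · exact isOpen_iUnion fun p => p.2.isOpen
  · refine IsPreconnected.ordConnected (isPreconnected_iUnion ⟨0, ?_⟩ fun p =>
      p.2.ordConnected.isPreconnected)
    exact mem_iInter.2 fun p => p.2.zero_mem
  · exact mem_iUnion.2 ⟨⟨(I, f), h⟩, h.zero_mem⟩
  · rw [hF ⟨(I, f), h⟩ (by simpa using h.zero_mem)]
    exact h.apply_zero
  · intro z hz
    obtain ⟨p, hp⟩ := mem_iUnion.1 hz
    exact hflat p z hp
  · intro J g hg
    exact subset_iUnion (fun p : {p : Set ℝ × (ℂ → M) // IsFlatStrip α c x p.1 p.2} => p.1.1)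
      ⟨(J, g), hg⟩

/-- A flat map on a strip that agrees somewhere with a maximal flat strip is a restriction of
it. -/
theorem IsMaxStrip.eq_of_overlap (hα : α ∈ holomorphicDifferentials M) (hc : c ≠ 0)
    (h : IsMaxStrip α c x I f) {J : Set ℝ} {g : ℂ → M} (hJ : IsOpen J) (hJ' : J.OrdConnected)
    (hg : ∀ z : ℂ, z.im ∈ J → FlatAt α c g z) {a : ℂ} (haI : a.im ∈ I) (haJ : a.im ∈ J)
    (heq : f a = g a) {z : ℂ} (hz : z.im ∈ J) : z.im ∈ I ∧ f z = g z := by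
  have : Nonempty M := ⟨x⟩
  have hcompat : EqOn f g (Complex.im ⁻¹' I ∩ Complex.im ⁻¹' J) :=
    eqOn_of_flatAt hα hc ((convex_im_preimage h.ordConnected).inter (convex_im_preimage hJ'))
      (fun z hz => h.flatAt z hz.1) (fun z hz => hg z hz.2) ⟨haI, haJ⟩ heq
  obtain ⟨F, hF, hflat⟩ := exists_glue (ι := Bool) (α := α) (c := c)
    (fun b => Complex.im ⁻¹' (bif b then I else J)) (fun b => bif b then f else g)
    (by rintro (_ | _); exacts [isOpen_im_preimage hJ, isOpen_im_preimage h.isOpen])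
    (by rintro (_ | _); exacts [hg, h.flatAt])
    (by
      rintro (_ | _) (_ | _)
      · exact fun _ _ => rfl
      · exact fun z hz => (hcompat hz.symm).symm
      · exact hcompat
      · exact fun _ _ => rfl)
  have hsub : I ∪ J ⊆ I := by
    refine h.maximal _ F ⟨h.isOpen.union hJ, ?_, Or.inl h.zero_mem, ?_, ?_⟩
    · exact (IsPreconnected.union a.im haI haJ h.ordConnected.isPreconnected
        hJ'.isPreconnected).ordConnected
    · rw [hF true (by simpa using h.zero_mem)]
      exact h.apply_zero
    · rintro z (hz | hz)
      exacts [hflat true z hz, hflat false z hz]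
  exact ⟨hsub (Or.inr hz), hcompat ⟨hsub (Or.inr hz), hz⟩⟩

theorem IsMaxStrip.eq_of_overlap_translate (hα : α ∈ holomorphicDifferentials M) (hc : c ≠ 0)
    (h : IsMaxStrip α c x I f) {J : Set ℝ} {g : ℂ → M} (hJ : IsOpen J) (hJ' : J.OrdConnected)
    (hg : ∀ z : ℂ, z.im ∈ J → FlatAt α c g z) {a b : ℂ} (ha : a.im ∈ I) (hb : b.im ∈ J)
    (heq : f a = g b) {w : ℂ} (hw : w.im ∈ J) :
    (w + (a - b)).im ∈ I ∧ f (w + (a - b)) = g w := by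
  have him : (b - a).im + (w + (a - b)).im = w.im := by simp; ring
  have key := h.eq_of_overlap hα hc (J := (fun y => (b - a).im + y) ⁻¹' J)
    (g := fun z => g ((b - a) + 1 * z)) (a := a) (z := w + (a - b))
    (hJ.preimage (by fun_prop)) (by
      refine ⟨fun y hy y' hy' t ht => hJ'.out hy hy' ⟨?_, ?_⟩⟩
      · simpa using ht.1
      · simpa using ht.2)
    (fun z hz => by
      have : FlatAt α c g ((b - a) + 1 * z) := hg _ (by simpa using hz)
      simpa using this.comp_affine)
    ha (by simpa using hb) (by simpa using heq)
    (show (b - a).im + (w + (a - b)).im ∈ J by rwa [him])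
  refine ⟨key.1, key.2.trans ?_⟩
  congr 1
  ring

theorem IsFlatStrip.periodic (hα : α ∈ holomorphicDifferentials M) (hc : c ≠ 0)
    (h : IsFlatStrip α c x I f) {ℓ : ℝ} (hℓ : f ℓ = f 0) {z : ℂ} (hz : z.im ∈ I) :
    f (z + ℓ) = f z := by
  have := eqOn_of_flatAt hα hc (convex_im_preimage h.ordConnected)
    (f := fun z => f (ℓ + 1 * z)) (g := f) (a := 0) (fun z hz => by
      have : FlatAt α c f (ℓ + 1 * z) := h.flatAt _ (by simpa using hz)
      simpa using this.comp_affine) h.flatAt (by simpa using h.zero_mem) (by simpa using hℓ) hz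
  simpa [add_comm] using this

/-- A geodesic, all of whose points have flat discs of radius `ρ` around them, extends to a flat
strip of half-width `ρ`. -/
theorem exists_strip_of_geodesic (hα : α ∈ holomorphicDifferentials M) (hc : c ≠ 0) {γ : ℝ → M}
    (hγ : ∀ t, FlatAt α c γ t) {ρ : ℝ} (hρ : 0 < ρ)
    (hdisc : ∀ t, ∃ g : ℂ → M, g 0 = γ t ∧ ∀ z ∈ Metric.ball (0 : ℂ) ρ, FlatAt α c g z) :
    ∃ g : ℂ → M, (∀ t : ℝ, g t = γ t) ∧ ∀ z : ℂ, z.im ∈ Ioo (-ρ) ρ → FlatAt α c g z := by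
  have : Nonempty M := ⟨γ 0⟩
  choose G hG0 hG using hdisc
  let f : ℝ → ℂ → M := fun t z => G t (-(t : ℂ) + 1 * z)
  have hf : ∀ t : ℝ, ∀ z ∈ Metric.ball (t : ℂ) ρ, FlatAt α c (f t) z := by
    intro t z hz
    have : FlatAt α c (G t) (-(t : ℂ) + 1 * z) := by
      refine hG t _ ?_
      rw [mem_ball_zero_iff]
      rw [Metric.mem_ball, dist_eq_norm] at hz
      rwa [one_mul, neg_add_eq_sub]
    simpa [f] using this.comp_affine
  have hreal : ∀ t s : ℝ, |s - t| < ρ → f t s = γ s := by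
    intro t s hs
    have hmem : ∀ r ∈ Ioo (t - ρ) (t + ρ), (r : ℂ) ∈ Metric.ball (t : ℂ) ρ := by
      intro r hr
      rw [Metric.mem_ball, dist_eq_norm, ← Complex.ofReal_sub, Complex.norm_real, Real.norm_eq_abs,
        abs_lt]
      constructor <;> linarith [hr.1, hr.2]
    refine eqOn_of_flatAt_real hα hc (ordConnected_Ioo (a := t - ρ) (b := t + ρ))
      (γ := fun r : ℝ => f t r) (γ' := γ) (fun r hr => ?_) (fun r _ => hγ r) (t₀ := t)
      ⟨by linarith, by linarith⟩ (by simp [f, hG0]) ?_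
    · have : FlatAt α c (f t) (0 + (r : ℂ) * 1) := hf t _ (by simpa using hmem r hr)
      simpa using this.comp_line
    · rw [abs_lt] at hs
      constructor <;> linarith [hs.1, hs.2]
  obtain ⟨F, hF, hflat⟩ := exists_glue (fun t : ℝ => Metric.ball (t : ℂ) ρ) f
    (fun t => Metric.isOpen_ball) hf (by
      intro t t' z hz
      -- The discs around `t` and `t'` meet in a convex set that contains the midpoint.
      have hlt : |t - t'| < 2 * ρ := by
        have h1 : dist (t : ℂ) t' < ρ + ρ :=
          (dist_triangle_left _ _ z).trans_lt (add_lt_add hz.1 hz.2)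
        rw [dist_eq_norm, ← Complex.ofReal_sub, Complex.norm_real, Real.norm_eq_abs] at h1
        linarith
      have hm1 : |(t + t') / 2 - t| < ρ := by
        rw [abs_lt] at hlt ⊢; constructor <;> linarith [hlt.1, hlt.2]
      have hm2 : |(t + t') / 2 - t'| < ρ := by
        rw [abs_lt] at hlt ⊢; constructor <;> linarith [hlt.1, hlt.2]
      refine eqOn_of_flatAt hα hc ((convex_ball (t : ℂ) ρ).inter (convex_ball (t' : ℂ) ρ))
        (fun w hw => hf t w hw.1) (fun w hw => hf t' w hw.2)
        (a := (((t + t') / 2 : ℝ) : ℂ)) ⟨?_, ?_⟩ ?_ hz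
      · rwa [Metric.mem_ball, dist_eq_norm, ← Complex.ofReal_sub, Complex.norm_real,
          Real.norm_eq_abs]
      · rwa [Metric.mem_ball, dist_eq_norm, ← Complex.ofReal_sub, Complex.norm_real,
          Real.norm_eq_abs]
      · rw [hreal t _ hm1, hreal t' _ hm2])
  refine ⟨F, fun t => ?_, fun z hz => hflat z.re z ?_⟩
  · rw [hF t (Metric.mem_ball_self hρ)]
    exact hreal t t (by simpa using hρ)
  · rw [Metric.mem_ball, dist_eq_norm]
    have : z - (z.re : ℂ) = (z.im : ℂ) * Complex.I := by
      rw [sub_eq_iff_eq_add']; exact (Complex.re_add_im z).symm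
    rw [this, norm_mul, Complex.norm_I, mul_one, Complex.norm_real, Real.norm_eq_abs, abs_lt]
    exact hz

theorem exists_isMaxStrip_of_mem_cylinders (hα : α ∈ holomorphicDifferentials M) {θ R : ℝ}
    (hx : x ∈ cylinders α θ R) :
    ∃ I f, IsMaxStrip α (Complex.exp (θ * Complex.I)) x I f ∧ ∃ ℓ : ℝ, 0 < ℓ ∧ ℓ ≤ R ∧
      ∀ z : ℂ, z.im ∈ I → f (z + ℓ) = f z := by
  obtain ⟨γ, ℓ, hγ, rfl, hℓ, hℓR, hper⟩ := hx
  rw [isRegularGeodesic_iff] at hγ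
  have hc := Complex.exp_ne_zero (θ * Complex.I)
  have hK : IsCompact (γ '' Icc 0 ℓ) := isCompact_Icc.image
    (continuous_iff_continuousAt.2 fun t => (hγ t).continuousAt)
  obtain ⟨ρ, hρ, hdisc⟩ := exists_uniform_disc hα hK (by
    rintro _ ⟨t, -, rfl⟩
    exact (hγ t).ne_zero hc)
  have himg : ∀ t, γ t ∈ γ '' Icc 0 ℓ := by
    intro t
    have := hper.image_Icc hℓ 0
    rw [zero_add] at this
    rw [this]
    exact mem_range_self t
  obtain ⟨g, hg, hflat⟩ := exists_strip_of_geodesic hα hc hγ hρ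
    (fun t => hdisc _ (himg t) _ (Complex.norm_exp_ofReal_mul_I θ))
  have hstrip : IsFlatStrip α (Complex.exp (θ * Complex.I)) (γ 0) (Ioo (-ρ) ρ) g :=
    ⟨isOpen_Ioo, ordConnected_Ioo, ⟨by linarith, hρ⟩, by simpa using hg 0, hflat⟩
  obtain ⟨I, f, hmax⟩ := hstrip.exists_isMaxStrip hα hc
  refine ⟨I, f, hmax, ℓ, hℓ, hℓR, fun z hz => hmax.periodic hα hc ?_ hz⟩
  have h1 : ∀ t : ℝ, f t = γ t := fun t => by
    rw [← hg t]
    exact (hmax.eq_of_overlap hα hc isOpen_Ioo ordConnected_Ioo hflat (a := 0)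
      (by simpa using hmax.zero_mem) (by simpa using hρ)
      (by rw [hmax.apply_zero, hstrip.apply_zero]) (by simpa using hρ)).2
  rw [h1 ℓ, hmax.apply_zero]
  simpa using hper 0

theorem isOpen_cylinders (hα : α ∈ holomorphicDifferentials M) (θ R : ℝ) :
    IsOpen (cylinders α θ R) := by
  rw [isOpen_iff_mem_nhds]
  intro x hx
  obtain ⟨I, f, hmax, ℓ, hℓ, hℓR, hper⟩ := exists_isMaxStrip_of_mem_cylinders hα hx
  have hopen := isOpen_image_of_flatAt hα (Complex.exp_ne_zero _) (isOpen_im_preimage hmax.isOpen)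
    hmax.flatAt
  refine Filter.mem_of_superset
    (hopen.mem_nhds ⟨0, by simpa using hmax.zero_mem, hmax.apply_zero⟩) ?_
  rintro _ ⟨z, hz, rfl⟩
  refine ⟨fun t : ℝ => f (z + (t : ℂ) * 1), ℓ, ?_, by simp, hℓ, hℓR, ?_⟩
  · rw [isRegularGeodesic_iff]
    intro t
    have : FlatAt α _ f (z + (t : ℂ) * 1) := hmax.flatAt _ (by simpa using hz)
    simpa using this.comp_line
  · intro t
    have := hper (z + (t : ℂ) * 1) (by simpa using hz)
    simp only [← this]
    congr 1
    push_cast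
    ring

/-- If the map of a maximal flat strip has a horizontal period and takes the same value at `0` and
at a point off the real axis, then it is doubly periodic. Its image is then compact and open, hence
all of `M`, and `α` has no zeros. -/
theorem IsMaxStrip.forall_ne_zero [ConnectedSpace M] (hα : α ∈ holomorphicDifferentials M)
    (hc : c ≠ 0) (h : IsMaxStrip α c x I f) {ℓ : ℝ} (hℓ : 0 < ℓ)
    (hper : ∀ z : ℂ, z.im ∈ I → f (z + ℓ) = f z) {z₀ : ℂ} (hz₀ : z₀.im ∈ I) (hne : z₀.im ≠ 0)
    (heq : f z₀ = x) (p : M) : α p ≠ 0 := by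
  -- By maximality the strip is invariant under translation by `-z₀`.
  have step : ∀ z : ℂ, z.im ∈ I → (z - z₀).im ∈ I ∧ f (z - z₀) = f z := by
    intro z hz
    have := h.eq_of_overlap_translate hα hc h.isOpen h.ordConnected h.flatAt (a := 0) (b := z₀)
      (by simpa using h.zero_mem) hz₀ (by rw [heq, h.apply_zero]) hz
    simpa [sub_eq_add_neg] using this
  have stepn : ∀ n : ℕ, ∀ z : ℂ, z.im ∈ I → (z - n * z₀).im ∈ I ∧ f (z - n * z₀) = f z := by
    intro n
    induction n with
    | zero => intro z hz; simpa using hz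
    | succ n ih =>
      intro z hz
      obtain ⟨h1, h2⟩ := ih z hz
      obtain ⟨h3, h4⟩ := step _ h1
      have : z - ((n + 1 : ℕ) : ℂ) * z₀ = z - n * z₀ - z₀ := by push_cast; ring
      rw [this]
      exact ⟨h3, h4.trans h2⟩
  have hneg : -z₀.im ∈ I := by
    have := (step 0 (by simpa using h.zero_mem)).1
    simpa using this
  have hIcc : uIcc 0 (-z₀.im) ⊆ I := h.ordConnected.uIcc_subset h.zero_mem hneg
  -- The image of the strip is the image of a compact fundamental parallelogram.
  have hcompact : f '' (Complex.im ⁻¹' I) = f '' (Icc 0 ℓ ×ℂ uIcc 0 (-z₀.im)) := by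
    apply Subset.antisymm
    · rintro _ ⟨z, hz, rfl⟩
      obtain ⟨w, hw, hwf⟩ : ∃ w : ℂ, w.im ∈ uIcc 0 (-z₀.im) ∧ f w = f z := by
        set n := ⌈z.im / z₀.im⌉ with hn
        have hlam : (z - n * z₀).im ∈ uIcc 0 (-z₀.im) := by
          have e1 : (z - n * z₀).im = -((n : ℝ) - z.im / z₀.im) * z₀.im := by
            simp
            field_simp
          have l1 : 0 ≤ (n : ℝ) - z.im / z₀.im := sub_nonneg.2 (Int.le_ceil _)
          have l2 : (n : ℝ) - z.im / z₀.im ≤ 1 := by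
            have := Int.ceil_lt_add_one (z.im / z₀.im)
            linarith
          rw [e1, mem_uIcc]
          rcases le_total 0 z₀.im with hs | hs
          · right; constructor <;> nlinarith
          · left; constructor <;> nlinarith
        refine ⟨_, hlam, ?_⟩
        obtain ⟨m, hm | hm⟩ := n.eq_nat_or_neg
        · rw [hm]
          exact_mod_cast (stepn m z hz).2
        · have := (stepn m _ (hIcc hlam)).2
          rw [← this]
          congr 1
          rw [hm]
          push_cast
          ring
      obtain ⟨w', hre, him, hw'⟩ := exists_re_mem_Icc_of_periodic hℓ hper (hIcc hw)
      exact ⟨w', ⟨hre, by rw [mem_preimage, him]; exact hw⟩, hw'.trans hwf⟩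
    · refine image_mono fun z hz => hIcc ?_
      rw [Complex.mem_reProdIm] at hz
      exact hz.2
  have hcl : IsClosed (f '' (Complex.im ⁻¹' I)) := by
    rw [hcompact]
    refine IsCompact.isClosed (IsCompact.image_of_continuousOn
      (isCompact_Icc.reProdIm isCompact_uIcc) fun z hz => ?_)
    rw [Complex.mem_reProdIm] at hz
    exact (h.flatAt z (hIcc hz.2)).continuousAt.continuousWithinAt
  have hop := isOpen_image_of_flatAt hα hc (isOpen_im_preimage h.isOpen) h.flatAt
  have huniv := IsClopen.eq_univ ⟨hcl, hop⟩ ⟨f 0, 0, by simpa using h.zero_mem, rfl⟩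
  obtain ⟨z, hz, rfl⟩ : p ∈ f '' (Complex.im ⁻¹' I) := huniv ▸ mem_univ p
  exact (h.flatAt z hz).ne_zero hc

/-- If a point lies on closed geodesics of two transverse directions `θ` and `φ`, then the maximal
strip of direction `θ` through it reaches, to either side of it, at most as far as the geodesic of
direction `φ` travels across the strip. -/
theorem IsMaxStrip.subset_Icc_of_mem_cylinders [ConnectedSpace M]
    (hα : α ∈ holomorphicDifferentials M) (hzero : ∃ p, α p = 0) {θ φ R ℓ : ℝ}
    (h : IsMaxStrip α (Complex.exp (θ * Complex.I)) x I f) (hℓ : 0 < ℓ)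
    (hper : ∀ z : ℂ, z.im ∈ I → f (z + ℓ) = f z) (hφ : x ∈ cylinders α φ R)
    (hsin : Real.sin (φ - θ) ≠ 0) :
    I ⊆ Icc (-(R * |Real.sin (φ - θ)|)) (R * |Real.sin (φ - θ)|) := by
  intro y hy
  rw [mem_Icc, ← abs_le]
  by_contra! hlt
  obtain ⟨γ, L, hγ, rfl, hL, hLR, hLper⟩ := hφ
  rw [isRegularGeodesic_iff] at hγ
  set s := Real.sin (φ - θ) with hs
  set d := Complex.exp (((φ - θ : ℝ) : ℂ) * Complex.I) with hd
  have hdim : d.im = s := by rw [hd, Complex.exp_ofReal_mul_I_im]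
  have hb : |L * s| < |y| := by
    rw [abs_mul, abs_of_pos hL]
    exact (mul_le_mul_of_nonneg_right hLR (abs_nonneg s)).trans_lt hlt
  -- Follow the geodesic of direction `φ` forwards or backwards, towards the height `y`.
  obtain ⟨T, hT, hTmem⟩ : ∃ T : ℝ, (T = L ∨ T = -L) ∧ T * s ∈ I := by
    have key : ∀ T : ℝ, (T = L ∨ T = -L) → 0 ≤ T * s * y → T * s ∈ I := by
      intro T hT hsign
      have habs : |T * s| < |y| := by
        rcases hT with rfl | rfl
        · exact hb
        · rwa [neg_mul, abs_neg]
      refine h.ordConnected.uIcc_subset h.zero_mem hy ?_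
      rw [mem_uIcc]
      rcases le_total 0 y with h0 | h0
      · left
        rw [abs_of_nonneg h0] at habs
        rcases h0.eq_or_lt with h00 | h00
        · rw [← h00] at habs; exact absurd habs (not_lt.2 (by positivity))
        · exact ⟨nonneg_of_mul_nonneg_left hsign h00, (le_abs_self _).trans habs.le⟩
      · right
        rw [abs_of_nonpos h0] at habs
        rcases h0.eq_or_lt with h00 | h00
        · rw [h00] at habs; simp at habs; exact absurd habs (not_lt.2 (by positivity))
        · refine ⟨by linarith [neg_abs_le (T * s)], ?_⟩
          by_contra! hpos
          nlinarith
    rcases le_total 0 (L * s * y) with h0 | h0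
    · exact ⟨L, Or.inl rfl, key L (Or.inl rfl) h0⟩
    · exact ⟨-L, Or.inr rfl, key (-L) (Or.inr rfl) (by linarith)⟩
  have heq := eqOn_of_flatAt_real hα (Complex.exp_ne_zero (φ * Complex.I))
    (γ := fun t : ℝ => f (0 + (t : ℂ) * d)) (γ' := γ) (S := (fun t : ℝ => t * s) ⁻¹' I)
    (by
      have := h.ordConnected.convex.linear_preimage (LinearMap.mulRight ℝ s)
      exact this.ordConnected)
    (fun t ht => by
      have h1 : FlatAt α _ f (0 + (t : ℂ) * d) := h.flatAt _ (by
        simpa [hdim] using ht)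
      have h2 := h1.comp_line
      have h3 : Complex.exp (θ * Complex.I) * d = Complex.exp (φ * Complex.I) := by
        rw [hd, ← Complex.exp_add]
        congr 1
        push_cast
        ring
      rwa [h3] at h2)
    (fun t _ => hγ t) (t₀ := 0) (by simpa using h.zero_mem) (by simpa using h.apply_zero)
    (show T * s ∈ I from hTmem)
  have hγT : γ T = γ 0 := by
    rcases hT with rfl | rfl
    · simpa using hLper 0
    · simpa using (hLper (-L)).symm
  obtain ⟨p, hp⟩ := hzero
  refine h.forall_ne_zero hα (Complex.exp_ne_zero _) hℓ hper (z₀ := (T : ℂ) * d) ?_ ?_ ?_ p hp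
  · simpa [hdim] using hTmem
  · have : ((T : ℂ) * d).im = T * s := by simp [hdim]
    rw [this]
    refine mul_ne_zero ?_ hsin
    rcases hT with rfl | rfl
    · exact hL.ne'
    · exact (neg_neg_of_pos hL).ne
  · rw [← hγT, ← heq]
    simp

end Strips

/-! ### Area of the image of a flat map -/

section Area

theorem hasFDerivAt_real_of_hasDerivAt {f : ℂ → ℂ} {v z : ℂ} (h : HasDerivAt f v z) :
    HasFDerivAt f (v • (1 : ℂ →L[ℝ] ℂ)) z := by
  have := h.hasFDerivAt.restrictScalars ℝ
  refine this.congr_fderiv ?_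
  ext x
  simp [mul_comm]

theorem det_smul_one (v : ℂ) : (v • (1 : ℂ →L[ℝ] ℂ)).det = ‖v‖ ^ 2 := by
  rw [← Complex.normSq_eq_norm_sq, ← Algebra.norm_complex_apply, Algebra.norm_apply]
  rw [ContinuousLinearMap.det]
  congr 1

theorem measurableSet_inter_preimage_of_continuousOn {X Y : Type*} [TopologicalSpace X]
    [MeasurableSpace X] [BorelSpace X] [TopologicalSpace Y] [MeasurableSpace Y] [BorelSpace Y]
    {f : X → Y} {A : Set X} (hA : IsOpen A) (hf : ContinuousOn f A) {B : Set Y}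
    (hB : MeasurableSet B) : MeasurableSet (A ∩ f ⁻¹' B) := by
  have h1 : Measurable (A.domRestrict f) := hf.domRestrict.measurable
  have h2 := hA.measurableSet.subtype_image (h1 hB)
  convert h2 using 1
  ext x
  simp [and_comm]

variable {M : Type*} [TopologicalSpace M] [ChartedSpace ℂ M] [IsManifold 𝓘(ℂ, ℂ) 1 M]
  [MeasurableSpace M] [BorelSpace M] {α : OneForm M}

/-- The area that `α` induces in a chart, compared with the Lebesgue measure in a flat chart. -/
theorem IsFlatChart.map_withDensity_apply_le {ψ : OpenPartialHomeomorph M ℂ} (hψ : IsFlatChart α ψ)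
    {e : OpenPartialHomeomorph M ℂ} (he : e ∈ atlas ℂ M) {B : Set M} (hB : MeasurableSet B)
    (hBψ : B ⊆ ψ.source) :
    Measure.map e.symm ((volume.restrict e.target).withDensity fun z => ‖coeff α e z‖ₑ ^ 2) B ≤
      volume (ψ.target ∩ ψ.symm ⁻¹' B) := by
  have hem : AEMeasurable e.symm
      ((volume.restrict e.target).withDensity fun z => ‖coeff α e z‖ₑ ^ 2) := by
    rw [← restrict_withDensity e.open_target.measurableSet]
    exact e.continuousOn_symm.aemeasurable e.open_target.measurableSet
  have hS : MeasurableSet (e.target ∩ e.symm ⁻¹' B) :=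
    measurableSet_inter_preimage_of_continuousOn e.open_target e.continuousOn_symm hB
  rw [Measure.map_apply_of_aemeasurable hem hB, ← restrict_withDensity e.open_target.measurableSet,
    Measure.restrict_apply' e.open_target.measurableSet, inter_comm, withDensity_apply _ hS]
  set T := ψ.target ∩ ψ.symm ⁻¹' (B ∩ e.source) with hT
  have hTm : MeasurableSet T := measurableSet_inter_preimage_of_continuousOn ψ.open_target
    ψ.continuousOn_symm (hB.inter e.open_source.measurableSet)
  have himg : (e ∘ ψ.symm) '' T = e.target ∩ e.symm ⁻¹' B := by
    apply Subset.antisymm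
    · rintro _ ⟨z, ⟨hz, hzB, hze⟩, rfl⟩
      refine ⟨e.map_source hze, ?_⟩
      simpa [e.left_inv hze] using hzB
    · rintro w ⟨hw, hwB⟩
      have := hBψ hwB
      refine ⟨ψ (e.symm w), ⟨ψ.map_source this, ?_⟩, ?_⟩
      · simp only [mem_preimage, ψ.left_inv this]
        exact ⟨hwB, e.map_target hw⟩
      · simp [ψ.left_inv this, e.right_inv hw]
  have hinj : InjOn (e ∘ ψ.symm) T := by
    intro z hz w hw hzw
    exact ψ.symm.injOn hz.1 hw.1 (e.injOn hz.2.2 hw.2.2 hzw)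
  have hder : ∀ z ∈ T, HasDerivAt (e ∘ ψ.symm) (deriv (e ∘ ψ.symm) z) z ∧
      coeff α e (e (ψ.symm z)) * deriv (e ∘ ψ.symm) z = 1 := by
    intro z hz
    obtain ⟨v, hv, h1⟩ := (hψ.flatAt_symm z hz.1).hasDerivAt_chart he hz.2.2
    rw [hv.deriv]
    exact ⟨hv, h1⟩
  rw [← himg, lintegral_image_eq_lintegral_abs_det_fderiv_mul volume hTm
    (fun z hz => (hasFDerivAt_real_of_hasDerivAt (hder z hz).1).hasFDerivWithinAt) hinj]
  calc ∫⁻ z in T, ENNReal.ofReal |(deriv (e ∘ ψ.symm) z • (1 : ℂ →L[ℝ] ℂ)).det| *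
        ‖coeff α e ((e ∘ ψ.symm) z)‖ₑ ^ 2 = ∫⁻ z in T, 1 := by
        refine setLIntegral_congr_fun hTm fun z hz => ?_
        simp only [det_smul_one, Function.comp_apply]
        rw [abs_of_nonneg (by positivity), ENNReal.ofReal_pow (norm_nonneg _), ofReal_norm,
          ← mul_pow, mul_comm, ← enorm_mul, (hder z hz).2]
        simp
    _ = volume T := by simp
    _ ≤ volume (ψ.target ∩ ψ.symm ⁻¹' B) :=
        measure_mono (inter_subset_inter_right _ (preimage_mono inter_subset_left))

/-- In a flat chart the area is at most the Lebesgue measure. -/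
theorem IsFlatChart.area_image_symm_le {ψ : OpenPartialHomeomorph M ℂ} (hψ : IsFlatChart α ψ)
    {T : Set ℂ} (hTψ : T ⊆ ψ.target) : area α (ψ.symm '' T) ≤ volume T := by
  -- A measure that dominates all the measures in the definition of `area`: Lebesgue measure in the
  -- flat chart, and infinite outside of it.
  set ν : Measure M := Measure.map ψ.symm (volume.restrict ψ.target) +
    (⊤ : ENNReal) • Measure.count.restrict ψ.sourceᶜ with hν
  have hψm : AEMeasurable ψ.symm (volume.restrict ψ.target) :=
    ψ.continuousOn_symm.aemeasurable ψ.open_target.measurableSet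
  have hle : area α ≤ ν := by
    refine iSup₂_le fun e he => Measure.le_iff.2 fun B hB => ?_
    by_cases hBψ : B ⊆ ψ.source
    · refine (hψ.map_withDensity_apply_le he hB hBψ).trans ?_
      rw [hν, Measure.add_apply, Measure.map_apply_of_aemeasurable hψm hB,
        Measure.restrict_apply' ψ.open_target.measurableSet, inter_comm]
      exact le_self_add
    · obtain ⟨x, hx, hxψ⟩ := not_subset.1 hBψ
      have : ν B = ⊤ := by
        rw [hν, Measure.add_apply, Measure.smul_apply,
          Measure.restrict_apply' ψ.open_source.measurableSet.compl, smul_eq_mul,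
          ENNReal.top_mul, add_top]
        rw [Ne, Measure.count_eq_zero_iff, ← Ne, ← nonempty_iff_ne_empty]
        exact ⟨x, hx, hxψ⟩
      rw [this]
      exact le_top
  have himg : ψ.symm '' T ⊆ ψ.source := by
    rintro _ ⟨z, hz, rfl⟩
    exact ψ.map_target (hTψ hz)
  -- A measurable hull of `T` in the target has a measurable image.
  set T' := toMeasurable volume T ∩ ψ.target with hT'
  have hT'm : MeasurableSet T' := (measurableSet_toMeasurable _ _).inter
    ψ.open_target.measurableSet
  have hT'i : MeasurableSet (ψ.symm '' T') := by
    have : ψ.symm '' T' = ψ.source ∩ ψ ⁻¹' T' :=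
      ψ.symm.image_eq_target_inter_inv_preimage inter_subset_right
    rw [this]
    exact measurableSet_inter_preimage_of_continuousOn ψ.open_source ψ.continuousOn hT'm
  have himg' : ψ.symm '' T' ⊆ ψ.source := by
    rintro _ ⟨z, hz, rfl⟩
    exact ψ.map_target hz.2
  calc area α (ψ.symm '' T) ≤ area α (ψ.symm '' T') :=
        measure_mono (image_mono fun z hz => ⟨subset_toMeasurable _ _ hz, hTψ hz⟩)
    _ ≤ ν (ψ.symm '' T') := hle _
    _ = volume (ψ.symm ⁻¹' (ψ.symm '' T') ∩ ψ.target) := by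
        rw [hν, Measure.add_apply, Measure.smul_apply, Measure.map_apply_of_aemeasurable hψm hT'i,
          Measure.restrict_apply' ψ.open_target.measurableSet,
          Measure.restrict_apply' ψ.open_source.measurableSet.compl]
        have : ψ.symm '' T' ∩ ψ.sourceᶜ = ∅ := by
          rw [← sdiff_eq, sdiff_eq_empty.2 himg']
        simp [this]
    _ ≤ volume (toMeasurable volume T) := by
        refine measure_mono ?_
        rintro z ⟨⟨w, hw, hwz⟩, hz⟩
        rw [← ψ.symm.injOn hw.2 hz hwz]
        exact hw.1
    _ = volume T := measure_toMeasurable T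

theorem volume_image_affine (a : ℂ) {c : ℂ} (hc : ‖c‖ = 1) {T : Set ℂ} (hT : MeasurableSet T) :
    volume ((fun w => a + c * w) '' T) = volume T := by
  have hc0 : c ≠ 0 := by rintro rfl; simp at hc
  have := lintegral_image_eq_lintegral_abs_det_fderiv_mul volume hT
    (fun z _ => (hasFDerivAt_real_of_hasDerivAt (hasDerivAt_affine a c z)).hasFDerivWithinAt)
    (fun z _ w _ h => mul_left_cancel₀ hc0 (add_left_cancel h)) (fun _ => 1)
  simpa [det_smul_one, hc] using this

/-- Flat maps do not increase area. -/
theorem area_image_le_of_flatAt [T2Space M] (hα : α ∈ holomorphicDifferentials M) {c : ℂ}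
    (hc : ‖c‖ = 1) {f : ℂ → M} {U : Set ℂ} (hU : IsOpen U) (hf : ∀ z ∈ U, FlatAt α c f z)
    {S : Set ℂ} (hS : MeasurableSet S) (hSU : S ⊆ U) : area α (f '' S) ≤ volume S := by
  have hc0 : c ≠ 0 := by rintro rfl; simp at hc
  have hloc : ∀ z ∈ U, ∃ ε > 0, ∀ T ⊆ Metric.ball z ε, MeasurableSet T →
      area α (f '' T) ≤ volume T := by
    intro z hz
    obtain ⟨ψ, hψ, a, ε, hε, h⟩ := FlatAt.eventuallyEq_symm hα hc0
      (Filter.mem_of_superset (hU.mem_nhds hz) hf)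
    refine ⟨ε, hε, fun T hT hTm => ?_⟩
    have : f '' T = ψ.symm '' ((fun w => a + c * w) '' T) := by
      rw [image_image]
      exact image_congr fun w hw => (h w (hT hw)).2
    rw [this, ← volume_image_affine a hc hTm]
    refine hψ.area_image_symm_le ?_
    rintro _ ⟨w, hw, rfl⟩
    exact (h w (hT hw)).1
  choose! ε hε hle using hloc
  obtain ⟨t, htU, htc, hcover⟩ := TopologicalSpace.countable_cover_nhdsWithin
    (f := fun z => Metric.ball z (ε z)) (s := U)
    (fun z hz => mem_nhdsWithin_of_mem_nhds (Metric.ball_mem_nhds z (hε z hz)))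
  rcases t.eq_empty_or_nonempty with rfl | hne
  · have : S = ∅ := by
      rw [← subset_empty_iff]
      simpa using hSU.trans hcover
    simp [this]
  obtain ⟨u, rfl⟩ := htc.exists_eq_range hne
  set D : ℕ → Set ℂ := fun n => Metric.ball (u n) (ε (u n)) with hD
  have hDm : ∀ n, MeasurableSet (S ∩ disjointed D n) := fun n =>
    hS.inter (MeasurableSet.disjointed (fun n => measurableSet_ball) n)
  have hSeq : S = ⋃ n, S ∩ disjointed D n := by
    rw [← inter_iUnion, iUnion_disjointed]
    refine (inter_eq_left.2 ?_).symm
    refine (hSU.trans hcover).trans ?_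
    rw [biUnion_range]
  calc area α (f '' S) ≤ ∑' n, area α (f '' (S ∩ disjointed D n)) := by
        conv_lhs => rw [hSeq, image_iUnion]
        exact measure_iUnion_le _
    _ ≤ ∑' n, volume (S ∩ disjointed D n) := by
        refine ENNReal.tsum_le_tsum fun n => ?_
        exact hle (u n) (htU (mem_range_self n)) _
          (inter_subset_right.trans (disjointed_subset D n)) (hDm n)
    _ = volume S := by
        conv_rhs => rw [hSeq]
        refine (measure_iUnion ?_ hDm).symm
        intro i j hij
        exact (disjoint_disjointed D hij).mono inter_subset_right inter_subset_right

theorem volume_reProdIm_Icc (a b c d : ℝ) :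
    volume (Icc a b ×ℂ Icc c d) = ENNReal.ofReal (b - a) * ENNReal.ofReal (d - c) := by
  have h := Complex.volume_preserving_equiv_real_prod.measure_preimage
    (s := Icc a b ×ˢ Icc c d) (measurableSet_Icc.prod measurableSet_Icc).nullMeasurableSet
  rw [Measure.volume_eq_prod, Measure.prod_prod, Real.volume_Icc, Real.volume_Icc] at h
  rw [← h]
  rfl

/-- The image of a flat strip is a cylinder, whose area is at most its circumference times its
height. -/
theorem IsFlatStrip.area_image_le [T2Space M] (hα : α ∈ holomorphicDifferentials M) {c : ℂ}
    (hc : ‖c‖ = 1) {x : M} {I : Set ℝ} {f : ℂ → M} (h : IsFlatStrip α c x I f) {ℓ r η : ℝ}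
    (hℓ : 0 < ℓ) (hℓr : ℓ ≤ r) (hper : ∀ z : ℂ, z.im ∈ I → f (z + ℓ) = f z)
    (hI : I ⊆ Icc (-η) η) :
    area α (f '' (Complex.im ⁻¹' I)) ≤ ENNReal.ofReal (r * (2 * η)) := by
  have hsub : f '' (Complex.im ⁻¹' I) ⊆ f '' (Icc 0 ℓ ×ℂ I) := by
    rintro _ ⟨w, hw, rfl⟩
    obtain ⟨w', hre, him, hw'⟩ := exists_re_mem_Icc_of_periodic hℓ hper hw
    exact ⟨w', ⟨hre, by rw [mem_preimage, him]; exact hw⟩, hw'⟩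
  have hη : 0 ≤ η := by
    have := hI h.zero_mem
    exact this.2
  have hm : MeasurableSet (Icc 0 ℓ ×ℂ I) :=
    (measurableSet_Icc.preimage Complex.measurable_re).inter
      (h.isOpen.measurableSet.preimage Complex.measurable_im)
  calc area α (f '' (Complex.im ⁻¹' I)) ≤ area α (f '' (Icc 0 ℓ ×ℂ I)) := measure_mono hsub
    _ ≤ volume (Icc 0 ℓ ×ℂ I) :=
        area_image_le_of_flatAt hα hc (isOpen_im_preimage h.isOpen) h.flatAt hm
          (fun z hz => (Complex.mem_reProdIm.1 hz).2)
    _ ≤ volume (Icc 0 ℓ ×ℂ Icc (-η) η) :=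
        measure_mono fun z hz => Complex.mem_reProdIm.2
          ⟨(Complex.mem_reProdIm.1 hz).1, hI (Complex.mem_reProdIm.1 hz).2⟩
    _ ≤ ENNReal.ofReal (r * (2 * η)) := by
        rw [volume_reProdIm_Icc, ← ENNReal.ofReal_mul (by linarith)]
        apply ENNReal.ofReal_le_ofReal
        nlinarith

end Area

/-! ### Zeros of a holomorphic differential -/

section Zeros

/-- A holomorphic function that is not constant near `z₀` takes each value near `z₀` a bounded
number of times: it is a multiple of the power of a local coordinate. -/
theorem exists_encard_fiber_le {P : ℂ → ℂ} {z₀ : ℂ} (hP : AnalyticAt ℂ P z₀) (hP0 : P z₀ = 0)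
    (hne : ¬ ∀ᶠ z in 𝓝 z₀, P z = 0) :
    ∃ ρ > 0, ∃ n : ℕ, (∀ z ∈ Metric.ball z₀ ρ, P z = 0 → z = z₀) ∧
      ∀ a, {z ∈ Metric.ball z₀ ρ | P z = a}.encard ≤ n := by
  obtain ⟨n, g, hg, hg0, hPg⟩ := hP.exists_eventuallyEq_pow_smul_nonzero_iff.2 hne
  have hn : n ≠ 0 := by
    rintro rfl
    have := hPg.self_of_nhds
    rw [hP0] at this
    simp at this
    exact hg0 this.symm
  -- `ψ ^ n` is a multiple of `P` and `ψ` is a local coordinate.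
  set h : ℂ → ℂ := fun z => (g z / g z₀) ^ ((n : ℂ)⁻¹) with hh
  have hh1 : AnalyticAt ℂ h z₀ := by
    refine (hg.div analyticAt_const hg0).cpow analyticAt_const ?_
    simp [div_self hg0]
  set ψ : ℂ → ℂ := fun z => (z - z₀) * h z with hψ
  have hψan : AnalyticAt ℂ ψ z₀ := (analyticAt_id.sub analyticAt_const).mul hh1
  have hψd : HasStrictDerivAt ψ 1 z₀ := by
    have h1 := hψan.hasStrictDerivAt
    have h2 : HasDerivAt ψ (1 * h z₀ + (z₀ - z₀) * deriv h z₀) z₀ :=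
      ((hasDerivAt_id z₀).sub_const z₀).mul hh1.differentiableAt.hasDerivAt
    rw [h2.deriv] at h1
    simpa [hh, div_self hg0] using h1
  have hψP : ∀ᶠ z in 𝓝 z₀, P z = g z₀ * ψ z ^ n := by
    filter_upwards [hPg] with z hz
    rw [hz, hψ]
    simp only [smul_eq_mul, mul_pow, hh]
    rw [Complex.cpow_nat_inv_pow _ hn]
    field_simp
  set Φ := (hψd.hasStrictFDerivAt_equiv one_ne_zero).toOpenPartialHomeomorph ψ with hΦ
  have hinj : InjOn ψ Φ.source := Φ.injOn
  have hsrc : Φ.source ∈ 𝓝 z₀ := Φ.open_source.mem_nhds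
    (hψd.hasStrictFDerivAt_equiv one_ne_zero).mem_toOpenPartialHomeomorph_source
  obtain ⟨ρ, hρ, hball⟩ := Metric.eventually_nhds_iff_ball.1 (hψP.and hsrc)
  have hψ0 : ψ z₀ = 0 := by simp [hψ]
  refine ⟨ρ, hρ, n, fun z hz hz0 => ?_, fun a => ?_⟩
  · have h1 := (hball z hz).1
    rw [hz0] at h1
    have h2 : ψ z = 0 := by
      rcases mul_eq_zero.1 h1.symm with h | h
      · exact absurd h hg0
      · exact pow_eq_zero_iff hn |>.1 h
    exact hinj (hball z hz).2 (hball z₀ (Metric.mem_ball_self hρ)).2 (h2.trans hψ0.symm)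
  · have hsub : ψ '' {z ∈ Metric.ball z₀ ρ | P z = a} ⊆
        (Polynomial.nthRoots n (a / g z₀)).toFinset := by
      rintro _ ⟨z, ⟨hz, hza⟩, rfl⟩
      rw [Finset.mem_coe, Multiset.mem_toFinset, Polynomial.mem_nthRoots (Nat.pos_of_ne_zero hn),
        eq_div_iff hg0, ← hza, (hball z hz).1, mul_comm]
    have hinj' : InjOn ψ {z ∈ Metric.ball z₀ ρ | P z = a} :=
      hinj.mono fun z hz => (hball z hz.1).2
    have hcard : (Polynomial.nthRoots n (a / g z₀)).toFinset.card ≤ n :=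
      (Multiset.toFinset_card_le _).trans (Polynomial.card_nthRoots n _)
    rw [← hinj'.encard_image]
    calc (ψ '' {z ∈ Metric.ball z₀ ρ | P z = a}).encard
        ≤ ((Polynomial.nthRoots n (a / g z₀)).toFinset : Set ℂ).encard := encard_le_encard hsub
      _ = (Polynomial.nthRoots n (a / g z₀)).toFinset.card := encard_coe_eq_coe_finsetCard _
      _ ≤ n := Nat.cast_le.2 hcard

variable {M : Type*} [TopologicalSpace M] [ChartedSpace ℂ M]

/-- Data describing a holomorphic differential `α` near an isolated zero `p`: a neighbourhood `V`,
a function `W` on it with `dW = α` and `W p = 0`, which takes each value at most `m` times, and a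
radius `δ` such that a flat map from a small convex set to `M` which meets the middle of `V` does
not leave `V`, and is inverse to `W` up to an affine map. -/
structure IsZeroChart (α : OneForm M) (p : M) (V : Set M) (W : M → ℂ) (m : ℕ) (δ : ℝ) : Prop where
  mem_nhds : V ∈ 𝓝 p
  continuousAt : ContinuousAt W p
  apply_zero : W p = 0
  pos : 0 < δ
  encard_le : ∀ a, {q ∈ V | W q = a}.encard ≤ m
  flat : ∀ {c : ℂ}, ‖c‖ = 1 → ∀ {f : ℂ → M} {T : Set ℂ}, IsOpen T → Convex ℝ T →
    (∀ z ∈ T, FlatAt α c f z) → ∀ {z₁ : ℂ}, z₁ ∈ T → T ⊆ Metric.ball z₁ δ → f z₁ ∈ V →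
    ‖W (f z₁)‖ < δ → ∀ z ∈ T, f z ∈ V ∧ W (f z) = W (f z₁) + c * (z - z₁)

theorem eventually_chart_nhdsNE {p : M} {s : ℂ → Prop}
    (h : ∀ᶠ z in 𝓝[≠] (chartAt ℂ p p), s z) : ∀ᶠ q in 𝓝[≠] p, s (chartAt ℂ p q) := by
  have hs : (chartAt ℂ p).source ∈ 𝓝 p := (chartAt ℂ p).open_source.mem_nhds (mem_chart_source ℂ p)
  rw [eventually_nhdsWithin_iff] at h ⊢
  filter_upwards [((chartAt ℂ p).continuousAt (mem_chart_source ℂ p)).eventually h, hs]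
    with q hq hqs hqp
  exact hq fun h => hqp ((chartAt ℂ p).injOn hqs (mem_chart_source ℂ p) h)

variable [IsManifold 𝓘(ℂ, ℂ) 1 M] {α : OneForm M}

theorem eventually_zero_or_ne_zero (hα : α ∈ holomorphicDifferentials M) (p : M) :
    (∀ᶠ q in 𝓝 p, α q = 0) ∨ ∀ᶠ q in 𝓝[≠] p, α q ≠ 0 := by
  set e := chartAt ℂ p with he
  have hem := chart_mem_atlas ℂ p
  have hps := mem_chart_source ℂ p
  have han : AnalyticAt ℂ (coeff α e) (e p) :=
    (hα e hem).analyticAt (e.open_target.mem_nhds (mem_chart_target ℂ p))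
  have hs : ∀ᶠ q in 𝓝 p, q ∈ e.source := e.open_source.mem_nhds hps
  have hiff : ∀ q ∈ e.source, coeff α e (e q) = 0 ↔ α q = 0 := by
    intro q hq
    rw [coeff_eq_zero_iff α hem (e.map_source hq), e.left_inv hq]
  rcases han.eventually_eq_zero_or_eventually_ne_zero with h | h
  · left
    filter_upwards [(e.continuousAt hps).eventually h, hs] with q hq hqs
    exact (hiff q hqs).1 hq
  · right
    filter_upwards [eventually_chart_nhdsNE h, nhdsWithin_le_nhds hs] with q hq hqs
    exact fun h0 => hq ((hiff q hqs).2 h0)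

theorem exists_isZeroChart [T2Space M] (hα : α ∈ holomorphicDifferentials M) {p : M}
    (hp : ∀ᶠ q in 𝓝[≠] p, α q ≠ 0) : ∃ V W m δ, IsZeroChart α p V W m δ := by
  obtain ⟨P, ρ, hP⟩ := exists_isPrimitiveAt hα p
  set e := chartAt ℂ p with he
  have hem : e ∈ atlas ℂ M := chart_mem_atlas ℂ p
  have hps : p ∈ e.source := mem_chart_source ℂ p
  have hpt : e p ∈ e.target := mem_chart_target ℂ p
  have hPan : AnalyticAt ℂ P (e p) :=
    DifferentiableOn.analyticAt (s := Metric.ball (e p) ρ)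
      (fun z hz => (hP.hasDerivAt z hz).differentiableAt.differentiableWithinAt)
      (Metric.ball_mem_nhds _ hP.pos)
  -- If `P` vanished near `e p`, so would its derivative, the coefficient of `α`.
  have hPne : ¬ ∀ᶠ z in 𝓝 (e p), P z = 0 := by
    intro h
    have h1 : ∀ᶠ z in 𝓝 (e p), coeff α e z = 0 := by
      filter_upwards [h.eventually_nhds, Metric.ball_mem_nhds _ hP.pos] with z hz hzb
      rw [← (hP.hasDerivAt z hzb).deriv]
      have : P =ᶠ[𝓝 z] fun _ => 0 := hz
      rw [this.deriv_eq, deriv_const]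
    have h3 : ∀ᶠ z in 𝓝[≠] (e p), coeff α e z ≠ 0 := by
      have hsymm : Tendsto e.symm (𝓝[≠] (e p)) (𝓝[≠] p) := by
        refine tendsto_nhdsWithin_iff.2 ⟨?_, ?_⟩
        · have := e.continuousAt_symm hpt
          rw [ContinuousAt, e.left_inv hps] at this
          exact this.mono_left nhdsWithin_le_nhds
        · filter_upwards [self_mem_nhdsWithin, nhdsWithin_le_nhds (e.open_target.mem_nhds hpt)]
            with z hz hzt hzp
          apply hz
          rw [mem_singleton_iff, ← show e.symm z = p from hzp, e.right_inv hzt]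
      filter_upwards [hsymm.eventually hp, nhdsWithin_le_nhds (e.open_target.mem_nhds hpt)]
        with z hz hzt h0
      exact hz ((coeff_eq_zero_iff α hem hzt).1 h0)
    obtain ⟨z, hz1, hz2⟩ := ((h1.filter_mono nhdsWithin_le_nhds).and h3).exists
    exact hz2 hz1
  obtain ⟨ρ', hρ', m, hzero, hfib⟩ := exists_encard_fiber_le hPan hP.apply_center hPne
  set r := min ρ ρ' / 2 with hr
  have hmin := lt_min hP.pos hρ'
  have hr0 : 0 < r := by positivity
  have hrρ : r < ρ := by have := min_le_left ρ ρ'; linarith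
  have hrρ' : r < ρ' := by have := min_le_right ρ ρ'; linarith
  have hPd : ∀ z ∈ Metric.closedBall (e p) r, HasDerivAt P (coeff α e z) z := fun z hz =>
    hP.hasDerivAt z (Metric.closedBall_subset_ball hrρ hz)
  -- The minimum of `‖P‖` on the boundary of the closed disc of radius `r`.
  obtain ⟨δ, hδ, hδle⟩ : ∃ δ > 0, ∀ z ∈ Metric.sphere (e p) r, 2 * δ ≤ ‖P z‖ := by
    have hcont : ContinuousOn (fun z => ‖P z‖) (Metric.sphere (e p) r) := fun z hz =>
      (hPd z (Metric.sphere_subset_closedBall hz)).continuousAt.norm.continuousWithinAt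
    obtain ⟨w, hw, hmin⟩ := (isCompact_sphere (e p) r).exists_isMinOn
      (NormedSpace.sphere_nonempty.2 hr0.le) hcont
    have hpos : 0 < ‖P w‖ := by
      rw [norm_pos_iff]
      intro h0
      have := hzero w (Metric.closedBall_subset_ball hrρ' (Metric.sphere_subset_closedBall hw)) h0
      rw [this, Metric.mem_sphere, dist_self] at hw
      exact hr0.ne hw
    exact ⟨‖P w‖ / 2, by positivity, fun z hz => by linarith [isMinOn_iff.1 hmin z hz]⟩
  set V : Set M := e.symm '' Metric.closedBall (e p) r with hV
  have hbt : Metric.closedBall (e p) r ⊆ e.target :=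
    (Metric.closedBall_subset_ball hrρ).trans hP.ball_subset
  have hVmem : ∀ q, q ∈ V ↔ q ∈ e.source ∧ e q ∈ Metric.closedBall (e p) r := by
    intro q
    constructor
    · rintro ⟨z, hz, rfl⟩
      exact ⟨e.map_target (hbt hz), by rwa [e.right_inv (hbt hz)]⟩
    · rintro ⟨h1, h2⟩
      exact ⟨e q, h2, e.left_inv h1⟩
  have hVclosed : IsClosed V := ((isCompact_closedBall (e p) r).image_of_continuousOn
    (e.continuousOn_symm.mono hbt)).isClosed
  have hWc : ∀ q ∈ V, ContinuousAt (fun q => P (e q)) q := by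
    intro q hq
    obtain ⟨h1, h2⟩ := (hVmem q).1 hq
    exact ContinuousAt.comp (f := e) (hPd _ h2).continuousAt (e.continuousAt h1)
  have hpV : p ∈ V := (hVmem p).2 ⟨hps, Metric.mem_closedBall_self hr0.le⟩
  refine ⟨V, fun q => P (e q), m, δ, ?_, hWc p hpV, hP.apply_center, hδ, ?_, ?_⟩
  · filter_upwards [e.open_source.mem_nhds hps,
      (e.continuousAt hps).eventually_mem (Metric.closedBall_mem_nhds _ hr0)] with q h1 h2
    exact (hVmem q).2 ⟨h1, h2⟩
  · intro a
    have hinj : InjOn e {q ∈ V | P (e q) = a} := e.injOn.mono fun q hq => ((hVmem q).1 hq.1).1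
    rw [← hinj.encard_image]
    refine (encard_le_encard ?_).trans (hfib a)
    rintro _ ⟨q, ⟨hq, hqa⟩, rfl⟩
    exact ⟨Metric.closedBall_subset_ball hrρ' ((hVmem q).1 hq).2, hqa⟩
  · -- The points of `T` with the required property form an open and closed subset.
    intro c hc f T hTo hTc hf z₁ hz₁ hTb hfz₁ hW
    set u : Set ℂ := {z ∈ T | f z ∈ V ∧ P (e (f z)) = P (e (f z₁)) + c * (z - z₁)} with hu
    have hTu : T ⊆ u := by
      refine hTc.isPreconnected.subset_of_closure_inter_subset ?_ ⟨z₁, hz₁, hz₁, hfz₁, by simp⟩ ?_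
      · -- The values of `P` on `u` are too small for a point of `u` to reach the boundary of `V`.
        rw [isOpen_iff_mem_nhds]
        rintro z ⟨hzT, hzV, hzP⟩
        have hlt : ‖P (e (f z))‖ < 2 * δ := by
          rw [hzP]
          calc ‖P (e (f z₁)) + c * (z - z₁)‖ ≤ ‖P (e (f z₁))‖ + ‖c * (z - z₁)‖ := norm_add_le _ _
            _ < δ + δ := by
              refine add_lt_add hW ?_
              rw [norm_mul, hc, one_mul, ← dist_eq_norm]
              exact hTb hzT
            _ = 2 * δ := by ring
        obtain ⟨hs, hb⟩ := (hVmem _).1 hzV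
        have hball : e (f z) ∈ Metric.ball (e p) r := by
          rcases (Metric.mem_closedBall.1 hb).lt_or_eq with h | h
          · exact h
          · exact absurd (hδle _ h) (not_le.2 hlt)
        have hfc := (hf z hzT).continuousAt
        have hev : ∀ᶠ w in 𝓝 z, w ∈ T ∧ f w ∈ e.source ∧ e (f w) ∈ Metric.ball (e p) r := by
          refine Filter.Eventually.and (hTo.mem_nhds hzT)
            ((hfc.eventually_mem (e.open_source.mem_nhds hs)).and ?_)
          exact (ContinuousAt.comp (f := f) (e.continuousAt hs) hfc).eventually_mem
            (Metric.isOpen_ball.mem_nhds hball)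
        obtain ⟨ε, hε, hεb⟩ := Metric.eventually_nhds_iff_ball.1 hev
        refine Metric.mem_nhds_iff.2 ⟨ε, hε, fun w hw => ⟨(hεb w hw).1, ?_, ?_⟩⟩
        · exact (hVmem _).2 ⟨(hεb w hw).2.1, Metric.ball_subset_closedBall (hεb w hw).2.2⟩
        · have hd : ∀ y ∈ Metric.ball z ε, HasDerivWithinAt
              (fun y => P (e (f y)) - c * y) 0 (Metric.ball z ε) y := by
            intro y hy
            have h1 := hP.hasDerivAt_comp (hf y (hεb y hy).1) (hεb y hy).2.1
              (Metric.ball_subset_ball hrρ.le (hεb y hy).2.2)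
            have h2 := h1.sub ((hasDerivAt_id y).const_mul c)
            simp only [mul_one, sub_self] at h2
            exact h2.hasDerivWithinAt
          have hb := (convex_ball z ε).norm_image_sub_le_of_norm_hasDerivWithin_le (C := 0) hd
            (by simp) (Metric.mem_ball_self hε) hw
          simp only [zero_mul, norm_le_zero_iff] at hb
          linear_combination hb + hzP
      · rintro z ⟨hz, hzT⟩
        have hfc := (hf z hzT).continuousAt
        have hfreq := mem_closure_iff_frequently.1 hz
        have hzV : f z ∈ V := hVclosed.mem_of_frequently_of_tendsto
          (hfreq.mono fun w hw => hw.2.1) hfc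
        refine ⟨hzT, hzV, ?_⟩
        have hcont : Tendsto (fun w => P (e (f w)) - (P (e (f z₁)) + c * (w - z₁))) (𝓝 z)
            (𝓝 (P (e (f z)) - (P (e (f z₁)) + c * (z - z₁)))) :=
          (ContinuousAt.comp (f := f) (hWc _ hzV) hfc).sub
            (Continuous.tendsto (by fun_prop) z)
        have := (isClosed_singleton (x := (0 : ℂ))).mem_of_frequently_of_tendsto
          (hfreq.mono fun w hw => by simp [hw.2.2]) hcont
        exact sub_eq_zero.1 this
    exact fun z hz => (hTu hz).2

theorem area_eq_zero_of_forall_eq_zero [MeasurableSpace M] (h : ∀ p, α p = 0) : area α = 0 := by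
  refine le_antisymm (iSup₂_le fun e he => ?_) (Measure.zero_le _)
  have : (volume.restrict e.target).withDensity (fun z => ‖coeff α e z‖ₑ ^ 2) = 0 := by
    have hz : (fun z => ‖coeff α e z‖ₑ ^ 2) =ᵐ[volume.restrict e.target] 0 := by
      filter_upwards [ae_restrict_mem e.open_target.measurableSet] with z hz
      rw [(coeff_eq_zero_iff α he hz).2 (h _)]
      simp
    rw [withDensity_congr_ae hz, withDensity_zero]
  rw [this, Measure.map_zero]

theorem eventually_ne_zero_of_area_ne_zero [MeasurableSpace M] [ConnectedSpace M]
    (hα : α ∈ holomorphicDifferentials M) (harea : area α univ ≠ 0) (p : M) :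
    ∀ᶠ q in 𝓝[≠] p, α q ≠ 0 := by
  set A : Set M := {p | ∀ᶠ q in 𝓝 p, α q = 0} with hA
  have hop : IsOpen A := isOpen_setOfPred_eventually_nhds
  have hcl : IsClosed A := by
    rw [← closure_subset_iff_isClosed]
    intro p hp
    rcases eventually_zero_or_ne_zero hα p with h | h
    · exact h
    · by_contra hpA
      rw [eventually_nhdsWithin_iff] at h
      obtain ⟨q, hqA, hq⟩ := ((mem_closure_iff_frequently.1 hp).and_eventually h).exists
      exact hq (fun hqp => hpA (hqp ▸ hqA)) hqA.self_of_nhds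
  rcases isClopen_iff.1 ⟨hcl, hop⟩ with h | h
  · exact (eventually_zero_or_ne_zero hα p).resolve_left fun hp =>
      notMem_empty p (h ▸ hp)
  · refine absurd ?_ harea
    rw [area_eq_zero_of_forall_eq_zero (α := α) fun p => ?_]
    · simp
    · have : p ∈ A := h ▸ mem_univ p
      exact this.self_of_nhds

theorem finite_zeros [MeasurableSpace M] [ConnectedSpace M] [CompactSpace M]
    (hα : α ∈ holomorphicDifferentials M) (harea : area α univ ≠ 0) : {p | α p = 0}.Finite := by
  have := (isCompact_univ (X := M)).induction_on (p := fun S => (S ∩ {p | α p = 0}).Finite)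
    (by simp) (fun s t hst ht => ht.subset (inter_subset_inter_left _ hst))
    (fun s t hs ht => by rw [union_inter_distrib_right]; exact hs.union ht)
    (fun p _ => by
      have h := eventually_ne_zero_of_area_ne_zero hα harea p
      rw [eventually_nhdsWithin_iff] at h
      refine ⟨_, mem_nhdsWithin_of_mem_nhds h, (finite_singleton p).subset ?_⟩
      rintro q ⟨hq, hq0⟩
      by_contra hqp
      exact hq hqp hq0)
  simpa using this

end Zeros

/-! ### Repulsion of directions -/

section Repulsion

variable {M : Type*} [TopologicalSpace M] [ChartedSpace ℂ M] {α : OneForm M} {c : ℂ}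

/-- The points whose maximal strip in direction `c` is a cylinder of circumference at most `r` and
extends at most by `η` to either side, and runs into the zero chart `(V, W)` along a vertical
segment of length at least `v`. -/
def separatrixSet (α : OneForm M) (c : ℂ) (r η : ℝ) (V : Set M) (W : M → ℂ) (v : ℝ) : Set M :=
  {x | ∃ I f ℓ z₀, IsMaxStrip α c x I f ∧ 0 < ℓ ∧ ℓ ≤ r ∧
    (∀ z : ℂ, z.im ∈ I → f (z + (ℓ : ℝ)) = f z) ∧ I ⊆ Icc (-η) η ∧
    ∀ v' ∈ Ioc 0 v, (z₀ - v' * Complex.I).im ∈ I ∧ f (z₀ - v' * Complex.I) ∈ V ∧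
      W (f (z₀ - v' * Complex.I)) = c * (-(v' * Complex.I))}

theorem separatrixSet_anti {r η : ℝ} {V : Set M} {W : M → ℂ} {v v' : ℝ} (h : v ≤ v') :
    separatrixSet α c r η V W v' ⊆ separatrixSet α c r η V W v := by
  rintro x ⟨I, f, ℓ, z₀, hmax, hℓ, hℓr, hper, hI, hz⟩
  exact ⟨I, f, ℓ, z₀, hmax, hℓ, hℓr, hper, hI, fun w hw => hz w ⟨hw.1, hw.2.trans h⟩⟩

variable [IsManifold 𝓘(ℂ, ℂ) 1 M] [T2Space M] {x : M} {I : Set ℝ} {f : ℂ → M}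

/-- The upper end of a maximal strip of finite height is caused by a zero of `α`: the upper half of
the closed-up strip accumulates at one. -/
theorem IsMaxStrip.exists_zero_mem_closure [CompactSpace M] (hα : α ∈ holomorphicDifferentials M)
    (hc : ‖c‖ = 1) (h : IsMaxStrip α c x I f) {ℓ : ℝ} (hℓ : 0 < ℓ)
    (hper : ∀ z : ℂ, z.im ∈ I → f (z + ℓ) = f z) (hI : BddAbove I) :
    ∃ p, α p = 0 ∧ p ∈ closure (f '' (Icc 0 ℓ ×ℂ (I ∩ Ici 0))) := by
  have hc0 : c ≠ 0 := by rintro rfl; simp at hc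
  -- Otherwise discs of a uniform radius around the points of a high horizontal line extend the
  -- strip beyond its upper end.
  by_contra! hcon
  obtain ⟨ρ, hρ, hdisc⟩ := exists_uniform_disc hα
    (isClosed_closure (s := f '' (Icc 0 ℓ ×ℂ (I ∩ Ici 0)))).isCompact
    (fun q hq h0 => hcon q h0 hq)
  have h0b : 0 ≤ sSup I := le_csSup hI h.zero_mem
  obtain ⟨u, huI, hu0, hub⟩ : ∃ u ∈ I, 0 ≤ u ∧ sSup I - ρ < u := by
    obtain ⟨u, hu, hlt⟩ := exists_lt_of_lt_csSup ⟨0, h.zero_mem⟩ (sub_lt_self (sSup I) hρ)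
    rcases le_total 0 u with h0 | h0
    · exact ⟨u, hu, h0, hlt⟩
    · exact ⟨0, h.zero_mem, le_rfl, hlt.trans_le h0⟩
  have hule : u ≤ sSup I := le_csSup hI huI
  have hγ : ∀ t : ℝ, FlatAt α c (fun t : ℝ => f ((u : ℂ) * Complex.I + (t : ℂ) * 1)) t := by
    intro t
    have : FlatAt α c f ((u : ℂ) * Complex.I + (t : ℂ) * 1) := h.flatAt _ (by simpa using huI)
    simpa using this.comp_line
  obtain ⟨g, hg, hflat⟩ := exists_strip_of_geodesic hα hc0 hγ hρ (fun t => by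
    refine hdisc _ (subset_closure ?_) c hc
    obtain ⟨w, hre, him, hw⟩ := exists_re_mem_Icc_of_periodic hℓ hper
      (w := (u : ℂ) * Complex.I + (t : ℂ) * 1) (by simpa using huI)
    refine ⟨w, Complex.mem_reProdIm.2 ⟨hre, ?_⟩, hw⟩
    rw [him]
    simpa using ⟨huI, hu0⟩)
  have hmem : sSup I ∈ I := by
    have := (h.eq_of_overlap_translate hα hc0 isOpen_Ioo ordConnected_Ioo hflat
      (a := (u : ℂ) * Complex.I) (b := 0) (by simpa using huI) (by simpa using hρ)
      (by simpa using (hg 0).symm) (w := ((sSup I - u : ℝ) : ℂ) * Complex.I)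
      (by
        simp only [Complex.mul_im, Complex.ofReal_re, Complex.I_im, mul_one, Complex.ofReal_im,
          Complex.I_re, mul_zero, add_zero]
        constructor <;> linarith)).1
    simpa using this
  obtain ⟨ε, hε, hball⟩ := Metric.isOpen_iff.1 h.isOpen _ hmem
  have : sSup I + ε / 2 ∈ I := hball (by
    rw [Metric.mem_ball, Real.dist_eq, add_sub_cancel_left, abs_of_pos (by positivity)]
    linarith)
  linarith [le_csSup hI this]

/-- At the upper end of a maximal strip of finite height there is a boundary point `z₀` at which
the strip runs vertically into a zero `p` of `α`. -/
theorem IsMaxStrip.exists_separatrix [CompactSpace M] (hα : α ∈ holomorphicDifferentials M)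
    (hc : ‖c‖ = 1) {V : M → Set M} {W : M → M → ℂ} {m : M → ℕ} {δ : M → ℝ}
    (hchart : ∀ p, α p = 0 → IsZeroChart α p (V p) (W p) (m p) (δ p))
    (h : IsMaxStrip α c x I f) {ℓ : ℝ} (hℓ : 0 < ℓ)
    (hper : ∀ z : ℂ, z.im ∈ I → f (z + ℓ) = f z) (hI : BddAbove I) :
    ∃ p, α p = 0 ∧ ∃ z₀ : ℂ, ∃ ε > (0 : ℝ), ∀ v ∈ Ioo 0 ε, (z₀ - v * Complex.I).im ∈ I ∧
      f (z₀ - v * Complex.I) ∈ V p ∧ W p (f (z₀ - v * Complex.I)) = c * (-(v * Complex.I)) := by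
  have hc0 : c ≠ 0 := by rintro rfl; simp at hc
  obtain ⟨p, hp0, hp⟩ := h.exists_zero_mem_closure hα hc hℓ hper hI
  have hp' := hchart p hp0
  set Q : Set ℂ := Icc 0 ℓ ×ℂ (I ∩ Ici 0) with hQ
  -- The filter of points of `Q` whose images are close to `p`.
  set F : Filter ℂ := comap f (𝓝 p) ⊓ 𝓟 Q with hF
  have hFne : F.NeBot := by
    have h1 : (𝓝 p ⊓ 𝓟 (f '' Q)).NeBot := mem_closure_iff_clusterPt.1 hp
    refine NeBot.mono (comap_inf_principal_neBot_of_image_mem h1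
      (mem_inf_of_right (mem_principal_self (f '' Q)))) ?_
    exact inf_le_inf_right _ (comap_mono inf_le_left)
  obtain ⟨z₀, hz₀, hcl⟩ : ∃ z₀ ∈ Icc 0 ℓ ×ℂ Icc 0 (sSup I), ClusterPt z₀ F := by
    refine (isCompact_Icc.reProdIm isCompact_Icc) ?_
    refine inf_le_right.trans (principal_mono.2 fun z hz => ?_)
    have := Complex.mem_reProdIm.1 hz
    exact Complex.mem_reProdIm.2 ⟨this.1, this.2.2, le_csSup hI this.2.1⟩
  set G : Filter ℂ := 𝓝 z₀ ⊓ F with hG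
  have hGne : G.NeBot := hcl
  have hG1 : G ≤ 𝓝 z₀ := inf_le_left
  have hGf : Tendsto f G (𝓝 p) :=
    tendsto_comap.mono_left (inf_le_right.trans inf_le_left)
  have hGQ : ∀ᶠ z in G, z ∈ Q := (inf_le_right.trans inf_le_right : G ≤ 𝓟 Q) (mem_principal_self Q)
  have him := (Complex.mem_reProdIm.1 hz₀).2
  -- The strip contains no zeros, so the limit point lies on its upper boundary.
  have hnot : z₀.im ∉ I := by
    intro hmem
    have hz := h.flatAt z₀ hmem
    have := tendsto_nhds_unique hGf (hz.continuousAt.tendsto.mono_left hG1)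
    exact hz.ne_zero hc0 (this ▸ hp0)
  have hpos : 0 < z₀.im := by
    rcases him.1.eq_or_lt with h0 | h0
    · exact absurd (h0 ▸ h.zero_mem) hnot
    · exact h0
  have hsub : ∀ u, 0 ≤ u → u < z₀.im → u ∈ I := by
    intro u hu0 hu
    obtain ⟨w, hw, hlt⟩ := exists_lt_of_lt_csSup ⟨0, h.zero_mem⟩ (hu.trans_le him.2)
    exact h.ordConnected.out h.zero_mem hw ⟨hu0, hlt.le⟩
  set T : Set ℂ := Metric.ball z₀ (δ p / 2) ∩ Complex.im ⁻¹' I with hT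
  have hδ := hp'.pos
  have hTo : IsOpen T := Metric.isOpen_ball.inter (isOpen_im_preimage h.isOpen)
  have hTc : Convex ℝ T := (convex_ball _ _).inter (convex_im_preimage h.ordConnected)
  have hW0 : Tendsto (fun z => W p (f z)) G (𝓝 0) := by
    have := hp'.continuousAt.tendsto
    rw [hp'.apply_zero] at this
    exact this.comp hGf
  have hev : ∀ᶠ z in G, z ∈ T ∧ f z ∈ V p ∧ ‖W p (f z)‖ < δ p := by
    have h1 : ∀ᶠ z in G, z ∈ Metric.ball z₀ (δ p / 2) :=
      hG1 (Metric.ball_mem_nhds _ (by positivity))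
    have h2 : ∀ᶠ z in G, f z ∈ V p := hGf hp'.mem_nhds
    have h3 : ∀ᶠ z in G, ‖W p (f z)‖ < δ p := by
      have := hW0.norm
      rw [norm_zero] at this
      exact this.eventually_lt_const hδ
    filter_upwards [h1, h2, h3, hGQ] with z hz1 hz2 hz3 hzQ
    exact ⟨⟨hz1, (Complex.mem_reProdIm.1 hzQ).2.1⟩, hz2, hz3⟩
  -- Let the reference point in `IsZeroChart.flat` tend to `z₀`.
  have key : ∀ z ∈ T, f z ∈ V p ∧ W p (f z) = c * (z - z₀) := by
    intro z hz
    have hev' : ∀ᶠ z₁ in G, f z ∈ V p ∧ W p (f z) = W p (f z₁) + c * (z - z₁) := by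
      filter_upwards [hev] with z₁ hz₁
      refine hp'.flat hc hTo hTc (fun w hw => h.flatAt w hw.2) hz₁.1 ?_ hz₁.2.1 hz₁.2.2 z hz
      intro w hw
      have h1 := Metric.mem_ball.1 hw.1
      have h2 := Metric.mem_ball.1 hz₁.1.1
      rw [Metric.mem_ball]
      linarith [dist_triangle_right w z₁ z₀]
    refine ⟨hev'.exists.choose_spec.1, ?_⟩
    have hlim : Tendsto (fun z₁ => W p (f z₁) + c * (z - z₁)) G (𝓝 (0 + c * (z - z₀))) :=
      hW0.add ((Continuous.tendsto (by fun_prop : Continuous fun z₁ => c * (z - z₁)) z₀).mono_left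
        hG1)
    rw [zero_add] at hlim
    exact tendsto_nhds_unique (tendsto_const_nhds.congr' (hev'.mono fun _ h => h.2)) hlim
  refine ⟨p, hp0, z₀, min (δ p / 2) z₀.im, lt_min (by positivity) hpos, fun v hv => ?_⟩
  have hv1 := hv.2.trans_le (min_le_left _ _)
  have hv2 := hv.2.trans_le (min_le_right _ _)
  have hIm : (z₀ - v * Complex.I).im ∈ I := by
    refine hsub _ ?_ ?_ <;> simp <;> linarith [hv.1]
  have := key (z₀ - v * Complex.I) ⟨by
    rw [Metric.mem_ball, dist_eq_norm, sub_sub_cancel_left, norm_neg, norm_mul, Complex.norm_I,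
      Complex.norm_real, mul_one, Real.norm_eq_abs, abs_of_pos hv.1]
    exact hv1, hIm⟩
  refine ⟨hIm, this.1, this.2.trans ?_⟩
  ring

/-- Points with the same point at distance `v` from the zero lie in the same cylinder, so the number
of cylinders is bounded by the number of preimages under `W`. -/
theorem area_separatrixSet_le [MeasurableSpace M] [BorelSpace M]
    (hα : α ∈ holomorphicDifferentials M) (hc : ‖c‖ = 1) {r η : ℝ} {V : Set M} {W : M → ℂ} {m : ℕ}
    (hm : ∀ a, {q ∈ V | W q = a}.encard ≤ m) {v : ℝ} (hv : 0 < v) :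
    area α (separatrixSet α c r η V W v) ≤ m * ENNReal.ofReal (r * (2 * η)) := by
  have hc0 : c ≠ 0 := by rintro rfl; simp at hc
  set Φ : Set M := {q ∈ V | W q = c * (-(v * Complex.I))} with hΦ
  have hΦfin : Φ.Finite := finite_of_encard_le_coe (hm _)
  set D : M → Set M := fun q => {x | ∃ I f ℓ z₀, IsMaxStrip α c x I f ∧ 0 < ℓ ∧ ℓ ≤ r ∧
    (∀ z : ℂ, z.im ∈ I → f (z + (ℓ : ℝ)) = f z) ∧ I ⊆ Icc (-η) η ∧
    (z₀ - v * Complex.I).im ∈ I ∧ f (z₀ - v * Complex.I) = q} with hD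
  have hDle : ∀ q, area α (D q) ≤ ENNReal.ofReal (r * (2 * η)) := by
    intro q
    rcases (D q).eq_empty_or_nonempty with h | ⟨x, I, f, ℓ, z₀, hmax, hℓ, hℓr, hper, hI, him, hq⟩
    · simp [h]
    refine (measure_mono ?_).trans (hmax.area_image_le hα hc hℓ hℓr hper hI)
    rintro y ⟨J, g, ℓ', z₁, hmax', -, -, -, -, him', hq'⟩
    obtain ⟨h1, h2⟩ := hmax.eq_of_overlap_translate hα hc0 hmax'.isOpen hmax'.ordConnected
      hmax'.flatAt him him' (hq.trans hq'.symm) (w := 0) (by simpa using hmax'.zero_mem)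
    exact ⟨_, h1, h2.trans hmax'.apply_zero⟩
  have hsub : separatrixSet α c r η V W v ⊆ ⋃ q ∈ hΦfin.toFinset, D q := by
    rintro x ⟨I, f, ℓ, z₀, hmax, hℓ, hℓr, hper, hI, hz⟩
    obtain ⟨h1, h2, h3⟩ := hz v ⟨hv, le_rfl⟩
    refine mem_iUnion₂.2 ⟨f (z₀ - v * Complex.I), ?_, I, f, ℓ, z₀, hmax, hℓ, hℓr, hper, hI, h1, rfl⟩
    rw [Set.Finite.mem_toFinset]
    exact ⟨h2, h3⟩
  have hcard : hΦfin.toFinset.card ≤ m := by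
    have := hm (c * (-(v * Complex.I)))
    rw [← hΦ, hΦfin.encard_eq_coe_toFinset_card] at this
    exact Nat.cast_le.1 this
  calc area α (separatrixSet α c r η V W v) ≤ area α (⋃ q ∈ hΦfin.toFinset, D q) :=
        measure_mono hsub
    _ ≤ ∑ q ∈ hΦfin.toFinset, area α (D q) := measure_biUnion_finset_le _ _
    _ ≤ ∑ q ∈ hΦfin.toFinset, ENNReal.ofReal (r * (2 * η)) := Finset.sum_le_sum fun q _ => hDle q
    _ = hΦfin.toFinset.card * ENNReal.ofReal (r * (2 * η)) := by
        rw [Finset.sum_const, nsmul_eq_mul]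
    _ ≤ m * ENNReal.ofReal (r * (2 * η)) := by
        gcongr

/-- The points on closed geodesics of two transverse directions cover an area bounded in terms of
the lengths and the angle. -/
theorem exists_area_inter_cylinders_le [CompactSpace M] [ConnectedSpace M] [MeasurableSpace M]
    [BorelSpace M] (hα : α ∈ holomorphicDifferentials M) (harea : area α univ ≠ 0)
    (hzero : ∃ p, α p = 0) : ∃ K : ℕ, ∀ θ φ r R : ℝ, Real.sin (φ - θ) ≠ 0 →
      area α (cylinders α θ r ∩ cylinders α φ R) ≤
        K * ENNReal.ofReal (r * (2 * (R * |Real.sin (φ - θ)|))) := by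
  have hchart : ∀ p, ∃ V W m δ, IsZeroChart α p V W m δ := fun p =>
    exists_isZeroChart hα (eventually_ne_zero_of_area_ne_zero hα harea p)
  choose V W m δ hchart using hchart
  have hfin := finite_zeros hα harea
  refine ⟨∑ p ∈ hfin.toFinset, m p, fun θ φ r R hsin => ?_⟩
  set η := R * |Real.sin (φ - θ)| with hη
  set c := Complex.exp (θ * Complex.I) with hcdef
  have hc : ‖c‖ = 1 := Complex.norm_exp_ofReal_mul_I θ
  set E : M → ℕ → Set M := fun p n => separatrixSet α c r η (V p) (W p) (1 / ((n : ℝ) + 1)) with hE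
  have hEmono : ∀ p, Monotone (E p) := fun p n k hnk =>
    separatrixSet_anti (one_div_le_one_div_of_le (by positivity) (by gcongr))
  have hEle : ∀ p, area α (⋃ n, E p n) ≤ m p * ENNReal.ofReal (r * (2 * η)) := by
    intro p
    rw [(hEmono p).measure_iUnion]
    exact iSup_le fun n => area_separatrixSet_le hα hc (hchart p).encard_le (by positivity)
  have hsub : cylinders α θ r ∩ cylinders α φ R ⊆ ⋃ p ∈ hfin.toFinset, ⋃ n, E p n := by
    rintro x ⟨hxθ, hxφ⟩
    obtain ⟨I, f, hmax, ℓ, hℓ, hℓr, hper⟩ := exists_isMaxStrip_of_mem_cylinders hα hxθ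
    have hI := hmax.subset_Icc_of_mem_cylinders hα hzero hℓ hper hxφ hsin
    obtain ⟨p, hp, z₀, ε, hε, hz⟩ := hmax.exists_separatrix hα hc (fun p _ => hchart p) hℓ hper
      (bddAbove_Icc.mono hI)
    obtain ⟨n, hn⟩ := exists_nat_one_div_lt hε
    refine mem_iUnion₂.2 ⟨p, by simpa using hp, mem_iUnion.2 ⟨n, ?_⟩⟩
    exact ⟨I, f, ℓ, z₀, hmax, hℓ, hℓr, hper, hI, fun v hv => hz v ⟨hv.1, hv.2.trans_lt hn⟩⟩
  calc area α (cylinders α θ r ∩ cylinders α φ R)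
      ≤ area α (⋃ p ∈ hfin.toFinset, ⋃ n, E p n) := measure_mono hsub
    _ ≤ ∑ p ∈ hfin.toFinset, area α (⋃ n, E p n) := measure_biUnion_finset_le _ _
    _ ≤ ∑ p ∈ hfin.toFinset, m p * ENNReal.ofReal (r * (2 * η)) :=
        Finset.sum_le_sum fun p _ => hEle p
    _ = (∑ p ∈ hfin.toFinset, m p : ℕ) * ENNReal.ofReal (r * (2 * η)) := by
        rw [← Finset.sum_mul, Nat.cast_sum]

/-- Directions repel: two directions of cylinders of total area at least `3 / 5` and of lengths at
most `r` and `R` make an angle of at least a constant times `1 / (r R)`, unless they are equal or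
opposite. -/
theorem exists_le_abs_sin [CompactSpace M] [ConnectedSpace M] [MeasurableSpace M] [BorelSpace M]
    (hα : α ∈ holomorphicDifferentials M) (harea : area α univ = 1) (hzero : ∃ p, α p = 0) :
    ∃ κ > 0, ∀ r R : ℝ, 0 < r → 0 < R → ∀ θ ∈ directions α r, ∀ φ ∈ directions α R,
      Real.sin (φ - θ) ≠ 0 → κ / (r * R) ≤ |Real.sin (φ - θ)| := by
  obtain ⟨K, hK⟩ := exists_area_inter_cylinders_le hα (by rw [harea]; exact one_ne_zero) hzero
  refine ⟨1 / (10 * (K + 1)), by positivity, fun r R hr hR θ hθ φ hφ hsin => ?_⟩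
  have h1 := hK θ φ r R hsin
  set X := cylinders α θ r
  set Y := cylinders α φ R
  have hXm : MeasurableSet X := (isOpen_cylinders hα θ r).measurableSet
  have hX : (3 / 5 : ENNReal) ≤ area α X := hθ.2
  have hY : (3 / 5 : ENNReal) ≤ area α Y := hφ.2
  have hsum : area α X + area α Y ≤ 1 + area α (X ∩ Y) := by
    rw [← measure_union_add_inter' hXm Y, ← harea]
    gcongr
    exact subset_univ _
  set s := |Real.sin (φ - θ)| with hs
  have hs0 : 0 ≤ s := abs_nonneg _
  have h2 : (3 / 5 + 3 / 5 : ENNReal) ≤ 1 + ENNReal.ofReal (K * (r * (2 * (R * s)))) := by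
    rw [ENNReal.ofReal_mul (by positivity), ENNReal.ofReal_natCast]
    exact (add_le_add hX hY).trans (hsum.trans (by gcongr))
  have h3 : (3 / 5 + 3 / 5 : ℝ) ≤ 1 + K * (r * (2 * (R * s))) := by
    have e1 : (3 / 5 + 3 / 5 : ENNReal) = ENNReal.ofReal (3 / 5 + 3 / 5) := by
      rw [ENNReal.ofReal_add (by norm_num) (by norm_num), ENNReal.ofReal_div_of_pos (by norm_num)]
      norm_num
    rw [e1, ← ENNReal.ofReal_one, ← ENNReal.ofReal_add (by norm_num) (by positivity)] at h2
    exact (ENNReal.ofReal_le_ofReal_iff (by positivity)).1 h2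
  rw [div_le_iff₀ (by positivity), div_le_iff₀ (by positivity)]
  nlinarith [mul_nonneg hs0 (mul_pos hr hR).le]

end Repulsion

/-! ### Existence of a zero -/

section Genus

variable {M : Type*} [TopologicalSpace M] [ChartedSpace ℂ M] [IsManifold 𝓘(ℂ, ℂ) 1 M]

/-- A holomorphic differential on a surface of genus at least two has a zero: otherwise its ratio
with any other one is a holomorphic function, hence constant. -/
theorem exists_zero_of_two_le_genus [CompactSpace M] [ConnectedSpace M] (hg : 2 ≤ genus M)
    {ω : OneForm M} (hω : ω ∈ holomorphicDifferentials M) : ∃ p, ω p = 0 := by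
  by_contra! hne
  have hmul : ∀ α ∈ holomorphicDifferentials M, ∃ a : ℂ, a • ω = α := by
    intro α hα
    have hd : MDifferentiable 𝓘(ℂ, ℂ) 𝓘(ℂ, ℂ) fun x => α.value x / ω.value x := by
      intro x
      set e := chartAt ℂ x with he
      have hem : e ∈ atlas ℂ M := chart_mem_atlas ℂ x
      have hxt : e x ∈ e.target := mem_chart_target ℂ x
      have hcω : ∀ z ∈ e.target, coeff ω e z ≠ 0 := fun z hz h =>
        hne _ ((coeff_eq_zero_iff ω hem hz).1 h)
      have h1 : DifferentiableAt ℂ (fun z => coeff α e z / coeff ω e z) (e x) :=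
        ((hα e hem).differentiableAt (e.open_target.mem_nhds hxt)).div
          ((hω e hem).differentiableAt (e.open_target.mem_nhds hxt)) (hcω _ hxt)
      have h2 : MDifferentiableAt 𝓘(ℂ, ℂ) 𝓘(ℂ, ℂ)
          ((fun z => coeff α e z / coeff ω e z) ∘ e) x :=
        h1.mdifferentiableAt.comp x (mdifferentiableAt_atlas hem (mem_chart_source ℂ x))
      refine h2.congr_of_eventuallyEq ?_
      filter_upwards [e.open_source.mem_nhds (mem_chart_source ℂ x)] with y hy
      have hyt := e.map_source hy
      have hy0 := hcω _ hyt
      simp only [Function.comp_apply]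
      rw [coeff_eq ω hem hyt] at hy0 ⊢
      rw [coeff_eq α hem hyt, mul_div_mul_left _ _ (left_ne_zero_of_mul hy0), e.left_inv hy]
    obtain ⟨a, ha⟩ := hd.exists_eq_const_of_compactSpace
    refine ⟨a, funext fun x => ContinuousLinearMap.ext fun v => ?_⟩
    have h0 : ω.value x ≠ 0 := fun h => hne x ((OneForm.value_eq_zero_iff ω x).1 h)
    have hax : α.value x / ω.value x = a := congrFun ha x
    have h1 := OneForm.apply_eq ω x v
    have h2 := OneForm.apply_eq α x v
    rw [div_eq_iff h0] at hax
    have key : ∀ w : ℂ, a * (w * ω.value x) = w * α.value x := fun w => by rw [hax]; ring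
    exact (congrArg (a * ·) h1).trans ((key v).trans h2.symm)
  have hle : genus M ≤ 1 := finrank_le_one ⟨ω, hω⟩ fun w => by
    obtain ⟨a, ha⟩ := hmul w w.2
    exact ⟨a, Subtype.ext ha⟩
  omega

end Genus

/-! ### Gaps between directions -/

section Gaps

theorem le_gap {S : Set ℝ} {θ δ : ℝ} (hθ : θ ∈ S) (hδ : δ ≤ Real.pi)
    (h : ∀ φ ∈ S, Real.sin (φ - θ) ≠ 0 → δ ≤ |Real.sin (φ - θ)|) : δ ≤ gap S θ := by
  refine le_csInf ⟨2 * Real.pi, by positivity, θ, hθ, 1, by push_cast; ring⟩ ?_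
  rintro d ⟨hd, φ, hφ, k, hk⟩
  have hsin : Real.sin d = Real.sin (φ - θ) := by
    rw [hk, ← Real.sin_add_int_mul_two_pi (φ - θ) k]
    congr 1
    ring
  by_cases h0 : Real.sin d = 0
  · obtain ⟨n, hn⟩ := Real.sin_eq_zero_iff.1 h0
    have hn1 : (1 : ℝ) ≤ n := by
      have : (0 : ℝ) < n := by
        rw [← hn] at hd
        exact pos_of_mul_pos_left hd Real.pi_pos.le
      exact_mod_cast this
    rw [← hn]
    nlinarith [Real.pi_pos]
  · calc δ ≤ |Real.sin (φ - θ)| := h φ hφ (hsin ▸ h0)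
      _ = |Real.sin d| := by rw [hsin]
      _ ≤ |d| := Real.abs_sin_le_abs
      _ = d := abs_of_pos hd

variable {M : Type*} [TopologicalSpace M] [ChartedSpace ℂ M] [MeasurableSpace M]

theorem directions_mono (α : OneForm M) {r R : ℝ} (h : r ≤ R) :
    directions α r ⊆ directions α R := by
  rintro θ ⟨hθ, harea⟩
  refine ⟨hθ, harea.trans (measure_mono ?_)⟩
  rintro x ⟨γ, ℓ, hγ, hx, h0, hℓ, hper⟩
  exact ⟨γ, ℓ, hγ, hx, h0, hℓ.trans h, hper⟩

/-- Directions that occur already for the length bound `κ R / σ` have gaps at least `σ / R ^ 2`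
among the directions for the length bound `R`. -/
theorem le_gapProportion {α : OneForm M} {κ c₁ c₂ R σ : ℝ} (hκ : 0 < κ) (hR : 0 < R) (hc₁ : 0 < c₁)
    (hc₂ : 0 < c₂)
    (hrep : ∀ r R : ℝ, 0 < r → 0 < R → ∀ θ ∈ directions α r, ∀ φ ∈ directions α R,
      Real.sin (φ - θ) ≠ 0 → κ / (r * R) ≤ |Real.sin (φ - θ)|)
    (hσ : κ ≤ σ) (hπ : σ / R ^ 2 ≤ Real.pi)
    (hlow : c₁ * (κ * R / σ) ^ 2 ≤ (directions α (κ * R / σ)).ncard)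
    (hlow' : c₁ * R ^ 2 ≤ (directions α R).ncard)
    (hup : ((directions α R).ncard : ℝ) ≤ c₂ * R ^ 2) :
    c₁ * κ ^ 2 / c₂ ≤ σ ^ 2 * gapProportion (directions α R) (σ / R ^ 2) := by
  have hσ0 : 0 < σ := hκ.trans_le hσ
  have hr : 0 < κ * R / σ := by positivity
  have hrR : κ * R / σ ≤ R := by
    rw [div_le_iff₀ hσ0]
    nlinarith
  have hN : (0 : ℝ) < (directions α R).ncard := lt_of_lt_of_le (by positivity) hlow'
  -- `ncard` is zero on infinite sets.
  have hfin : (directions α R).Finite := finite_of_ncard_pos (by exact_mod_cast hN)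
  have hsub : directions α (κ * R / σ) ⊆
      {θ ∈ directions α R | σ / R ^ 2 ≤ gap (directions α R) θ} := by
    intro θ hθ
    refine ⟨directions_mono α hrR hθ, le_gap (directions_mono α hrR hθ) hπ fun φ hφ hsin => ?_⟩
    have := hrep _ R hr hR θ hθ φ hφ hsin
    convert this using 1
    field_simp
  have hcard : ((directions α (κ * R / σ)).ncard : ℝ) ≤
      {θ ∈ directions α R | σ / R ^ 2 ≤ gap (directions α R) θ}.ncard := by
    exact_mod_cast ncard_le_ncard hsub (hfin.subset (sep_subset _ _))
  unfold gapProportion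
  rw [← mul_div_assoc, div_le_div_iff₀ hc₂ hN]
  calc c₁ * κ ^ 2 * (directions α R).ncard ≤ c₁ * κ ^ 2 * (c₂ * R ^ 2) := by gcongr
    _ = σ ^ 2 * (c₁ * (κ * R / σ) ^ 2) * c₂ := by field_simp
    _ ≤ σ ^ 2 * {θ ∈ directions α R | σ / R ^ 2 ≤ gap (directions α R) θ}.ncard * c₂ := by
        gcongr
        exact hlow.trans hcard

end Gaps

end TranslationSurface

theorem mainTheorem12 {M : Type*} [TopologicalSpace M] [T2Space M] [CompactSpace M]
    [ConnectedSpace M] [ChartedSpace ℂ M] [IsManifold 𝓘(ℂ, ℂ) 1 M]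
    [MeasurableSpace M] [BorelSpace M]
    (hg : 2 ≤ TranslationSurface.genus M)
    (ω : TranslationSurface.OneForm M)
    (hω : ω ∈ TranslationSurface.holomorphicDifferentials M)
    (harea : TranslationSurface.area ω Set.univ = 1)
    (hquad : Asymptotics.IsTheta atTop
      (fun R : ℝ => ((TranslationSurface.directions ω R).ncard : ℝ)) (fun R : ℝ => R ^ 2)) :
    0 < liminf (fun σ : ℝ => liminf (fun R : ℝ =>
      ((σ ^ 2 * TranslationSurface.gapProportion (TranslationSurface.directions ω R)
        (σ / R ^ 2) : ℝ) : EReal)) atTop) atTop := by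
  obtain ⟨κ, hκ, hrep⟩ := TranslationSurface.exists_le_abs_sin hω harea
    (TranslationSurface.exists_zero_of_two_le_genus hg hω)
  obtain ⟨c₂, hc₂, hup⟩ := hquad.1.exists_pos
  obtain ⟨b, hb, hlow⟩ := hquad.2.exists_pos
  obtain ⟨R₀, hR₀⟩ := eventually_atTop.1 (hup.bound.and hlow.bound)
  have hbounds : ∀ R, R₀ ≤ R →
      b⁻¹ * R ^ 2 ≤ ((TranslationSurface.directions ω R).ncard : ℝ) ∧
      ((TranslationSurface.directions ω R).ncard : ℝ) ≤ c₂ * R ^ 2 := by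
    intro R hR
    obtain ⟨h1, h2⟩ := hR₀ R hR
    simp only [Real.norm_eq_abs, Nat.abs_cast, abs_of_nonneg (sq_nonneg R)] at h1 h2
    exact ⟨(inv_mul_le_iff₀ hb).2 h2, h1⟩
  have hpos : (0 : EReal) < ((b⁻¹ * κ ^ 2 / c₂ : ℝ) : EReal) := by
    exact_mod_cast (by positivity : (0 : ℝ) < b⁻¹ * κ ^ 2 / c₂)
  refine hpos.trans_le (le_liminf_of_le (h := ?_))
  filter_upwards [eventually_ge_atTop κ] with σ hσ
  have hσ0 : 0 < σ := hκ.trans_le hσ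
  refine le_liminf_of_le (h := ?_)
  have hlim : Tendsto (fun R : ℝ => σ / R ^ 2) atTop (nhds 0) :=
    tendsto_const_nhds.div_atTop (tendsto_pow_atTop two_ne_zero)
  filter_upwards [eventually_gt_atTop 0, eventually_ge_atTop R₀, eventually_ge_atTop (R₀ * σ / κ),
    hlim.eventually_le_const Real.pi_pos] with R hR hRR₀ hRσ hπ
  have hr : R₀ ≤ κ * R / σ := by
    rw [le_div_iff₀ hσ0]
    rw [div_le_iff₀ hκ] at hRσ
    linarith
  exact EReal.coe_le_coe_iff.2 (TranslationSurface.le_gapProportion hκ hR (inv_pos.2 hb) hc₂ hrep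
    hσ hπ (hbounds _ hr).1 (hbounds R hRR₀).1 (hbounds R hRR₀).2)
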